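/- Fix integers $\tilde K,\hat K\ge 1$ and parameters $\alpha,\beta,\gamma\in\{-1,0,1\}$. An instance consists of $n$ elements, two category maps $\tilde o:\{1,\dots,n\}\to\{1,\dots,\tilde K\}$ and $\hat o:\{1,\dots,n\}\to\{1,\dots,\hat K\}$ (smaller category numbers being better), and coefficients $f_1,\dots,f_n\ge 0$. For $x\in\{0,1\}^n$ let $\tilde c(x)\in\mathbb Z^{\tilde K}$ be the incremental counting vector $\tilde c_j(x)=\sum_{i:\,j\le \tilde o(i)}x_i$ (the number of selected elements in category $j$ or worse), let $\hat c(x)\in\mathbb Z^{\hat K}$ be defined in the same way from $\hat o$, let $f(x)=\sum_{i=1}^n f_i x_i$, and let $$z(x)=\bigl(\alpha\,\tilde c(x),\ \beta\,\hat c(x),\ \gamma f(x)\bigr).$$ Problem $\alpha\beta\gamma$-OMUCO is to minimize $z(x)$ subject to $x\in\{0,1\}^n$; problem $\alpha\beta\gamma$-OMCOCC, whose instances contain in addition an integer $w\in\{0,\dots,n\}$, is to minimize $z(x)$ subject to $x\in\{0,1\}^n$ and $\sum_{i=1}^n x_i=w$. A feasible solution $x$ is efficient if there is no feasible $y$ with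 $z(y)\le z(x)$ componentwise and $z(y)\ne z(x)$. The nondominated set $Z_N$ is the set of the outcome vectors $z(x)$ of all efficient $x$, and a minimal complete set $\bar X_E$ is a set of efficient solutions that contains exactly one preimage of each element of $Z_N$. Then, for fixed $\tilde K,\hat K$ (and $\alpha,\beta,\gamma$), the nondominated set $Z_N$ and a minimal complete set $\bar X_E$ of $\alpha\beta\gamma$-OMUCO can be computed in polynomial time, and the same holds for $\alpha\beta\gamma$-OMCOCC. Here polynomial time means that there is one program of a random access machine such that (i) for real coefficients $f_i$, its cost is bounded by a polynomial in $n$, where exact additions, subtractions, multiplications and comparisons of real numbers cost one unit each and integers and addresses are charged by their binary length, and (ii) for rational coefficients $f_i$, its cost, with all numbers charged by their binary length, is bounded by a polynomial in the binary encoding length of the instance. -/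

import Mathlib

namespace OrdMUCO

/-! ### Instances, outcome vectors, efficiency -/

/-- An instance with `n` elements, two ordinal objectives with `Kt` and `Kh` categories
(the category with index `j` is better than the one with index `k` if `j < k`), and one sum
objective with nonnegative coefficients `f` in `F`. -/
structure Inst (F : Type) [Zero F] [LE F] (Kt Kh n : ℕ) where
  catT : Fin n → Fin Kt
  catH : Fin n → Fin Kh
  f : Fin n → F
  f_nonneg : ∀ i, 0 ≤ f i

/-- A solution `x ∈ {0,1}^n`; `true` stands for `1`. -/
abbrev Sol (n : ℕ) : Type := Fin n → Bool

/-- The number `x_i ∈ {0,1}`. -/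
def bit {n : ℕ} (x : Sol n) (i : Fin n) : ℤ := if x i then 1 else 0

/-- The entry `c^i_j` of the binary cost matrix of an ordinal objective with category map `o`. -/
def costEntry {n K : ℕ} (o : Fin n → Fin K) (i : Fin n) (j : Fin K) : ℤ :=
  if j ≤ o i then 1 else 0

/-- The incremental counting vector: component `j` of `c(x) = ∑ i, x_i c^i` is the number of
selected elements that are in category `j` or worse. -/
def countVec {n K : ℕ} (o : Fin n → Fin K) (x : Sol n) (j : Fin K) : ℤ :=
  ∑ i, costEntry o i j * bit x i

/-- The sum objective `f(x) = ∑ i, f_i x_i`. -/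
def sumObj {F : Type} [Ring F] {n : ℕ} (f : Fin n → F) (x : Sol n) : F :=
  ∑ i, f i * (bit x i : F)

/-- Outcome vectors, with the componentwise order. -/
abbrev Outcome (F : Type) (Kt Kh : ℕ) : Type := (Fin Kt → ℤ) × (Fin Kh → ℤ) × F

/-- `z(x) = (α c̃(x), β ĉ(x), γ f(x))`. -/
def outcome {F : Type} [Ring F] [LinearOrder F] {Kt Kh n : ℕ} (α β γ : ℤ)
    (I : Inst F Kt Kh n) (x : Sol n) : Outcome F Kt Kh :=
  (fun j => α * countVec I.catT x j, fun j => β * countVec I.catH x j, (γ : F) * sumObj I.f x)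

/-- `a` dominates `b`. -/
def Dominates {F : Type} [LinearOrder F] {Kt Kh : ℕ} (a b : Outcome F Kt Kh) : Prop :=
  a ≤ b ∧ a ≠ b

/-- The efficient solutions of `min z(x)` subject to `x ∈ X`. -/
def efficientSet {F : Type} [LinearOrder F] {Kt Kh n : ℕ} (X : Set (Sol n))
    (z : Sol n → Outcome F Kt Kh) : Set (Sol n) :=
  {x | x ∈ X ∧ ¬ ∃ y ∈ X, Dominates (z y) (z x)}

/-- The nondominated set of `min z(x)` subject to `x ∈ X`. -/
def nondominatedSet {F : Type} [LinearOrder F] {Kt Kh n : ℕ} (X : Set (Sol n))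
    (z : Sol n → Outcome F Kt Kh) : Set (Outcome F Kt Kh) :=
  z '' efficientSet X z

/-- `S` consists of exactly one efficient solution for each nondominated outcome vector. -/
def IsMinimalComplete {F : Type} [LinearOrder F] {Kt Kh n : ℕ} (X : Set (Sol n))
    (z : Sol n → Outcome F Kt Kh) (S : Set (Sol n)) : Prop :=
  S ⊆ efficientSet X z ∧ ∀ v ∈ nondominatedSet X z, ∃! x, x ∈ S ∧ z x = v

/-- The solutions with exactly `w` selected elements. -/
def cardFeasible (n w : ℕ) : Set (Sol n) := {x | ∑ i, bit x i = (w : ℤ)}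

/-! ### The machine model

A random access machine, programmed by structured programs, whose memory consists of integer and
`F`-valued registers and arrays (array cells are addressed by integers). Programs contain no
constants from `F`, so the same program runs over every ordered ring `F`.

Every operation is charged one unit plus the size of its result (operands and addresses are
results of operations themselves, so they are charged as well). Integers, including addresses,
have their binary length as size. The size of elements of `F` is a parameter `rs` of the cost
measure: constantly one for exact real arithmetic, binary length for rational numbers. -/

/-- Integer expressions. -/
inductive IExp : Type
  | const (c : ℤ)
  | var (r : ℕ)
  | arr (a : ℕ) (idx : IExp)
  | add (e₁ e₂ : IExp)
  | sub (e₁ e₂ : IExp)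
  | mul (e₁ e₂ : IExp)

/-- Expressions with values in `F`. -/
inductive RExp : Type
  | ofInt (e : IExp)
  | var (r : ℕ)
  | arr (a : ℕ) (idx : IExp)
  | add (e₁ e₂ : RExp)
  | sub (e₁ e₂ : RExp)
  | mul (e₁ e₂ : RExp)

/-- Tests. -/
inductive BExp : Type
  | leI (e₁ e₂ : IExp)
  | leR (e₁ e₂ : RExp)
  | not (b : BExp)
  | and (b₁ b₂ : BExp)

/-- Programs. -/
inductive Prog : Type
  | skip
  | setIVar (r : ℕ) (e : IExp)
  | setIArr (a : ℕ) (idx e : IExp)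
  | setRVar (r : ℕ) (e : RExp)
  | setRArr (a : ℕ) (idx : IExp) (e : RExp)
  | seq (p q : Prog)
  | ite (b : BExp) (p q : Prog)
  | loop (b : BExp) (p : Prog)

/-- Memory contents. -/
structure Mem (F : Type) where
  ivar : ℕ → ℤ
  iarr : ℕ → ℤ → ℤ
  rvar : ℕ → F
  rarr : ℕ → ℤ → F

/-- Binary length of an integer, with one bit for the sign. -/
def intSize (a : ℤ) : ℕ := Nat.size a.natAbs + 1

/-- Binary length of a rational number (numerator and denominator in lowest terms). -/
def ratSize (q : ℚ) : ℕ := intSize q.num + Nat.size q.den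

/-- In exact real arithmetic every real number counts as one unit. -/
def realSize (_ : ℝ) : ℕ := 1

section Semantics

variable {F : Type} [Ring F] [LinearOrder F]

def IExp.val (s : Mem F) : IExp → ℤ
  | .const c => c
  | .var r => s.ivar r
  | .arr a idx => s.iarr a (idx.val s)
  | .add e₁ e₂ => e₁.val s + e₂.val s
  | .sub e₁ e₂ => e₁.val s - e₂.val s
  | .mul e₁ e₂ => e₁.val s * e₂.val s

def IExp.cost (s : Mem F) : IExp → ℕ
  | .const c => 1 + intSize c
  | .var r => 1 + intSize (s.ivar r)
  | .arr a idx => idx.cost s + 1 + intSize (s.iarr a (idx.val s))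
  | .add e₁ e₂ => e₁.cost s + e₂.cost s + 1 + intSize (e₁.val s + e₂.val s)
  | .sub e₁ e₂ => e₁.cost s + e₂.cost s + 1 + intSize (e₁.val s - e₂.val s)
  | .mul e₁ e₂ => e₁.cost s + e₂.cost s + 1 + intSize (e₁.val s * e₂.val s)

def RExp.val (s : Mem F) : RExp → F
  | .ofInt e => (e.val s : F)
  | .var r => s.rvar r
  | .arr a idx => s.rarr a (idx.val s)
  | .add e₁ e₂ => e₁.val s + e₂.val s
  | .sub e₁ e₂ => e₁.val s - e₂.val s
  | .mul e₁ e₂ => e₁.val s * e₂.val s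

def RExp.cost (rs : F → ℕ) (s : Mem F) : RExp → ℕ
  | .ofInt e => e.cost s + 1 + rs (e.val s : F)
  | .var r => 1 + rs (s.rvar r)
  | .arr a idx => idx.cost s + 1 + rs (s.rarr a (idx.val s))
  | .add e₁ e₂ => e₁.cost rs s + e₂.cost rs s + 1 + rs (e₁.val s + e₂.val s)
  | .sub e₁ e₂ => e₁.cost rs s + e₂.cost rs s + 1 + rs (e₁.val s - e₂.val s)
  | .mul e₁ e₂ => e₁.cost rs s + e₂.cost rs s + 1 + rs (e₁.val s * e₂.val s)

def BExp.Holds (s : Mem F) : BExp → Prop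
  | .leI e₁ e₂ => e₁.val s ≤ e₂.val s
  | .leR e₁ e₂ => e₁.val s ≤ e₂.val s
  | .not b => ¬ b.Holds s
  | .and b₁ b₂ => b₁.Holds s ∧ b₂.Holds s

def BExp.cost (rs : F → ℕ) (s : Mem F) : BExp → ℕ
  | .leI e₁ e₂ => e₁.cost s + e₂.cost s + 1
  | .leR e₁ e₂ => e₁.cost rs s + e₂.cost rs s + 1
  | .not b => b.cost rs s + 1
  | .and b₁ b₂ => b₁.cost rs s + b₂.cost rs s + 1

/-- `Exec rs p s t s'`: started with memory `s`, the program `p` halts with memory `s'`, and the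
total cost of the computation is `t`. -/
inductive Exec (rs : F → ℕ) : Prog → Mem F → ℕ → Mem F → Prop
  | skip (s : Mem F) : Exec rs .skip s 1 s
  | setIVar (r : ℕ) (e : IExp) (s : Mem F) :
      Exec rs (.setIVar r e) s (e.cost s + 1)
        { s with ivar := Function.update s.ivar r (e.val s) }
  | setIArr (a : ℕ) (idx e : IExp) (s : Mem F) :
      Exec rs (.setIArr a idx e) s (idx.cost s + e.cost s + 1)
        { s with iarr := Function.update s.iarr a
                  (Function.update (s.iarr a) (idx.val s) (e.val s)) }
  | setRVar (r : ℕ) (e : RExp) (s : Mem F) :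
      Exec rs (.setRVar r e) s (e.cost rs s + 1)
        { s with rvar := Function.update s.rvar r (e.val s) }
  | setRArr (a : ℕ) (idx : IExp) (e : RExp) (s : Mem F) :
      Exec rs (.setRArr a idx e) s (idx.cost s + e.cost rs s + 1)
        { s with rarr := Function.update s.rarr a
                  (Function.update (s.rarr a) (idx.val s) (e.val s)) }
  | seq {p q : Prog} {s s₁ s₂ : Mem F} {t₁ t₂ : ℕ} :
      Exec rs p s t₁ s₁ → Exec rs q s₁ t₂ s₂ → Exec rs (.seq p q) s (t₁ + t₂) s₂
  | iteTrue {b : BExp} {p q : Prog} {s s₁ : Mem F} {t : ℕ} :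
      b.Holds s → Exec rs p s t s₁ → Exec rs (.ite b p q) s (b.cost rs s + 1 + t) s₁
  | iteFalse {b : BExp} {p q : Prog} {s s₁ : Mem F} {t : ℕ} :
      ¬ b.Holds s → Exec rs q s t s₁ → Exec rs (.ite b p q) s (b.cost rs s + 1 + t) s₁
  | loopDone {b : BExp} {p : Prog} {s : Mem F} :
      ¬ b.Holds s → Exec rs (.loop b p) s (b.cost rs s + 1) s
  | loopStep {b : BExp} {p : Prog} {s s₁ s₂ : Mem F} {t₁ t₂ : ℕ} :
      b.Holds s → Exec rs p s t₁ s₁ → Exec rs (.loop b p) s₁ t₂ s₂ →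
      Exec rs (.loop b p) s (b.cost rs s + 1 + t₁ + t₂) s₂

/-! ### Input and output conventions -/

/-- The array holding `v 0, …, v (n-1)` in the cells `0, …, n-1`, and `0` elsewhere. -/
def toArray {A : Type} [Zero A] {n : ℕ} (v : Fin n → A) (a : ℤ) : A :=
  if h : 0 ≤ a ∧ a < n then v ⟨a.toNat, by omega⟩ else 0

/-- The initial memory: integer registers `0` and `1` hold `n` and `w`, the integer arrays `0` and
`1` hold the category numbers (counted from one), the `F`-array `0` holds the coefficients `f`;
everything else is zero. (The parameter `w` is zero if there is no cardinality constraint.) -/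
def Inst.input {Kt Kh n : ℕ} (I : Inst F Kt Kh n) (w : ℕ) : Mem F where
  ivar r := if r = 0 then (n : ℤ) else if r = 1 then (w : ℤ) else 0
  iarr a := if a = 0 then toArray (fun i => ((I.catT i : ℕ) : ℤ) + 1)
    else if a = 1 then toArray (fun i => ((I.catH i : ℕ) : ℤ) + 1) else fun _ => 0
  rvar _ := 0
  rarr a := if a = 0 then toArray I.f else fun _ => 0

/-- The encoding length of the input. -/
def Inst.inputSize {Kt Kh n : ℕ} (rs : F → ℕ) (I : Inst F Kt Kh n) (w : ℕ) : ℕ :=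
  intSize n + intSize w +
    ∑ i, (intSize (((I.catT i : ℕ) : ℤ) + 1) + intSize (((I.catH i : ℕ) : ℤ) + 1) + rs (I.f i))

/-- The memory lists the solutions in `S`, each exactly once: their number is in integer register
`0`, and the `t`-th of them is in the cells `t n, …, t n + n - 1` of integer array `0`. -/
def ListsSolutions {n : ℕ} (s : Mem F) (S : Set (Sol n)) : Prop :=
  ∃ (N : ℕ) (L : Fin N → Sol n), Function.Injective L ∧ Set.range L = S ∧
    s.ivar 0 = N ∧ ∀ (t : Fin N) (i : Fin n), s.iarr 0 ((t : ℤ) * n + (i : ℤ)) = bit (L t) i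

/-- The memory lists the outcome vectors in `Z`, each exactly once: their number is in integer
register `1`, and the three parts of the `t`-th of them are in the cells `t Kt, …, t Kt + Kt - 1`
of integer array `1`, the cells `t Kh, …, t Kh + Kh - 1` of integer array `2`, and the cell `t` of
the `F`-array `0`. -/
def ListsOutcomes {Kt Kh : ℕ} (s : Mem F) (Z : Set (Outcome F Kt Kh)) : Prop :=
  ∃ (N : ℕ) (L : Fin N → Outcome F Kt Kh), Function.Injective L ∧ Set.range L = Z ∧
    s.ivar 1 = N ∧
    (∀ (t : Fin N) (j : Fin Kt), s.iarr 1 ((t : ℤ) * Kt + (j : ℤ)) = (L t).1 j) ∧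
    (∀ (t : Fin N) (j : Fin Kh), s.iarr 2 ((t : ℤ) * Kh + (j : ℤ)) = (L t).2.1 j) ∧
    (∀ t : Fin N, s.rarr 0 (t : ℤ) = (L t).2.2)

/-- The memory holds the nondominated set and a minimal complete set of `min z(x)`, `x ∈ X`. -/
def IsCorrectOutput {Kt Kh n : ℕ} (X : Set (Sol n)) (z : Sol n → Outcome F Kt Kh)
    (s : Mem F) : Prop :=
  ListsOutcomes s (nondominatedSet X z) ∧
    ∃ S : Set (Sol n), IsMinimalComplete X z S ∧ ListsSolutions s S

/-- On all instances of the unconstrained problem with coefficients in `F`, the program `P`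
computes the nondominated set and a minimal complete set, at a cost that is bounded by a
polynomial in the encoding length of the input. -/
def SolvesOMUCO (rs : F → ℕ) (Kt Kh : ℕ) (α β γ : ℤ) (P : Prog) : Prop :=
  ∃ p : Polynomial ℕ, ∀ (n : ℕ) (I : Inst F Kt Kh n),
    ∃ (t : ℕ) (s : Mem F), Exec rs P (I.input 0) t s ∧ t ≤ p.eval (I.inputSize rs 0) ∧
      IsCorrectOutput Set.univ (outcome α β γ I) s

/-- The same for the problem with the cardinality constraint `∑ i, x_i = w`, where
`w ∈ {0, …, n}` is part of the input. -/
def SolvesOMCOCC (rs : F → ℕ) (Kt Kh : ℕ) (α β γ : ℤ) (P : Prog) : Prop :=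
  ∃ p : Polynomial ℕ, ∀ (n : ℕ) (I : Inst F Kt Kh n) (w : ℕ), w ≤ n →
    ∃ (t : ℕ) (s : Mem F), Exec rs P (I.input w) t s ∧ t ≤ p.eval (I.inputSize rs w) ∧
      IsCorrectOutput (cardFeasible n w) (outcome α β γ I) s

end Semantics

end OrdMUCO

/-!
The counting vectors of a solution and its cardinality have entries between `0` and `n`, so for
fixed numbers of categories they take only polynomially many values, which we encode as the digits
of a key. The outcomes of solutions with the same key differ only in the third objective, hence one
solution per key that is optimal for the third objective suffices. These solutions are found by a
dynamic program over the elements, because adding an element shifts the key by a constant, and a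
minimal complete set is then selected by comparing all pairs of them.

Every expression in a fixed program increases the sizes of its operands by at most a constant
factor. The running time is therefore polynomial as soon as all memory contents during the run have
sizes polynomial in the encoding length of the input.
-/

namespace OrdMUCO

local notation "nReg" => (0 : ℕ)
local notation "wReg" => (1 : ℕ)
local notation "keysReg" => (2 : ℕ)
local notation "elemReg" => (3 : ℕ)
local notation "rowReg" => (4 : ℕ)
local notation "shiftReg" => (5 : ℕ)
local notation "fillReg" => (6 : ℕ)
local notation "rivalReg" => (7 : ℕ)
local notation "keepReg" => (8 : ℕ)
local notation "countReg" => (9 : ℕ)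
local notation "sweepReg" => (10 : ℕ)
local notation "catTArr" => (0 : ℕ)
local notation "catHArr" => (1 : ℕ)
local notation "flagArr" => (3 : ℕ)
local notation "bitsArr" => (4 : ℕ)
local notation "compsArr" => (5 : ℕ)
local notation "entryArr" => (6 : ℕ)
local notation "coeffArr" => (0 : ℕ)
local notation "valueArr" => (1 : ℕ)
-- The output overwrites the category and coefficient arrays, which the selection does not read.
local notation "solArr" => (0 : ℕ)
local notation "fstArr" => (1 : ℕ)
local notation "sndArr" => (2 : ℕ)
local notation "outArr" => (0 : ℕ)

/-! ### Binary lengths -/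

theorem natSize_le_self (a : ℕ) : Nat.size a ≤ a :=
  Nat.size_le.2 Nat.lt_two_pow_self

theorem natSize_mul_le (a b : ℕ) : Nat.size (a * b) ≤ Nat.size a + Nat.size b := by
  rw [Nat.size_le, pow_add]
  exact Nat.mul_lt_mul'' (Nat.lt_size_self a) (Nat.lt_size_self b)

theorem natSize_add_le (a b : ℕ) : Nat.size (a + b) ≤ max (Nat.size a) (Nat.size b) + 1 := by
  rw [Nat.size_le, pow_succ, mul_two]
  refine Nat.add_lt_add ((Nat.lt_size_self a).trans_le ?_) ((Nat.lt_size_self b).trans_le ?_)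
  exacts [Nat.pow_le_pow_right two_pos (le_max_left _ _),
    Nat.pow_le_pow_right two_pos (le_max_right _ _)]

theorem one_le_intSize (a : ℤ) : 1 ≤ intSize a :=
  Nat.le_add_left 1 _

theorem intSize_le_of_abs_le {a : ℤ} {V : ℕ} (h : |a| ≤ V) : intSize a ≤ V + 1 := by
  have := natSize_le_self a.natAbs
  rw [Int.abs_eq_natAbs] at h
  unfold intSize
  omega

theorem intSize_add_le (a b : ℤ) : intSize (a + b) ≤ intSize a + intSize b := by
  have h₁ := Nat.size_le_size (Int.natAbs_add_le a b)
  have h₂ := natSize_add_le a.natAbs b.natAbs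
  unfold intSize
  omega

theorem intSize_sub_le (a b : ℤ) : intSize (a - b) ≤ intSize a + intSize b := by
  simpa [sub_eq_add_neg, intSize] using intSize_add_le a (-b)

theorem intSize_mul_le (a b : ℤ) : intSize (a * b) ≤ intSize a + intSize b := by
  have := natSize_mul_le a.natAbs b.natAbs
  unfold intSize
  rw [Int.natAbs_mul]
  omega

/-- The size measure `rs` on `F` grows by at most the factor `C` under the ring operations. Sums of
many terms are bounded separately because iterating `add_le` would yield an exponential factor. -/
structure IsSizeMeasure {F : Type} [Ring F] (rs : F → ℕ) (C : ℕ) : Prop where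
  int_le : ∀ z : ℤ, rs (z : F) ≤ C * intSize z
  add_le : ∀ a b, rs (a + b) ≤ C * (rs a + rs b)
  sub_le : ∀ a b, rs (a - b) ≤ C * (rs a + rs b)
  mul_le : ∀ a b, rs (a * b) ≤ C * (rs a + rs b)
  sum_le : ∀ {ι : Type} (t : Finset ι) (g : ι → F),
    rs (∑ i ∈ t, g i) ≤ C * (1 + ∑ i ∈ t, rs (g i))

/-! ### Memory -/

section Memory

variable {F : Type}

/-- The absolute values of all integers in the memory, and the sizes of all its elements of `F`,
are at most `V`. -/
structure Mem.Bounded (rs : F → ℕ) (V : ℕ) (s : Mem F) : Prop where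
  ivar_le : ∀ r, |s.ivar r| ≤ V
  iarr_le : ∀ a i, |s.iarr a i| ≤ V
  rvar_le : ∀ r, rs (s.rvar r) ≤ V
  rarr_le : ∀ a i, rs (s.rarr a i) ≤ V

/-- The array `A` with the values `v 0, …, v (N - 1)` written to the cells from `d` on. -/
def fillCells (A : ℤ → ℤ) (d : ℤ) (N : ℕ) (v : ℕ → ℤ) (j : ℤ) : ℤ :=
  if d ≤ j ∧ j < d + N then v (j - d).toNat else A j

/-- The memory after an assignment to an integer register. -/
def Mem.setI (s : Mem F) (r : ℕ) (v : ℤ) : Mem F :=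
  { s with ivar := Function.update s.ivar r v }

/-- The memory after an assignment to a cell of an integer array. -/
def Mem.setIA (s : Mem F) (a : ℕ) (i v : ℤ) : Mem F :=
  { s with iarr := Function.update s.iarr a (Function.update (s.iarr a) i v) }

/-- The memory after an assignment to a cell of an `F`-array. -/
def Mem.setRA (s : Mem F) (a : ℕ) (i : ℤ) (v : F) : Mem F :=
  { s with rarr := Function.update s.rarr a (Function.update (s.rarr a) i v) }

/-- The memory after `N` consecutive cells of an integer array have been filled, with the number
of filled cells left in the loop counter. -/
def Mem.fill (s : Mem F) (a : ℕ) (d : ℤ) (N : ℕ) (v : ℕ → ℤ) : Mem F :=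
  { s with
    ivar := Function.update s.ivar fillReg N
    iarr := Function.update s.iarr a (fillCells (s.iarr a) d N v) }

section Lookup

variable (s : Mem F) (r r' a b : ℕ) (i d : ℤ) (N : ℕ) (v : ℤ) (u : F) (g : ℕ → ℤ)

@[simp] theorem Mem.setI_ivar : (s.setI r v).ivar r' = if r' = r then v else s.ivar r' := by
  simp [Mem.setI, Function.update_apply]

@[simp] theorem Mem.setI_iarr : (s.setI r v).iarr = s.iarr := rfl

@[simp] theorem Mem.setI_rarr : (s.setI r v).rarr = s.rarr := rfl

@[simp] theorem Mem.setIA_ivar : (s.setIA a i v).ivar = s.ivar := rfl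

@[simp] theorem Mem.setIA_iarr : (s.setIA a i v).iarr b =
    if b = a then Function.update (s.iarr b) i v else s.iarr b := by
  by_cases h : b = a
  · subst h; simp [Mem.setIA]
  · simp [Mem.setIA, h]

@[simp] theorem Mem.setIA_rarr : (s.setIA a i v).rarr = s.rarr := rfl

@[simp] theorem Mem.setRA_ivar : (s.setRA a i u).ivar = s.ivar := rfl

@[simp] theorem Mem.setRA_iarr : (s.setRA a i u).iarr = s.iarr := rfl

@[simp] theorem Mem.setRA_rarr : (s.setRA a i u).rarr b =
    if b = a then Function.update (s.rarr b) i u else s.rarr b := by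
  by_cases h : b = a
  · subst h; simp [Mem.setRA]
  · simp [Mem.setRA, h]

@[simp] theorem Mem.fill_ivar : (s.fill a d N g).ivar r =
    if r = fillReg then (N : ℤ) else s.ivar r := by
  simp [Mem.fill, Function.update_apply]

@[simp] theorem Mem.fill_iarr : (s.fill a d N g).iarr b =
    if b = a then fillCells (s.iarr b) d N g else s.iarr b := by
  by_cases h : b = a
  · subst h; simp [Mem.fill]
  · simp [Mem.fill, h]

@[simp] theorem Mem.fill_rarr : (s.fill a d N g).rarr = s.rarr := rfl

theorem Mem.fill_zero : s.fill a d 0 g = s.setI fillReg 0 := by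
  have : fillCells (s.iarr a) d 0 g = s.iarr a := by
    funext j
    exact if_neg (by push_cast; omega)
  simp [Mem.fill, Mem.setI, this]

theorem Mem.fill_succ : s.fill a d (N + 1) g =
    ((s.fill a d N g).setIA a (d + N) (g N)).setI fillReg (N + 1) := by
  have : fillCells (s.iarr a) d (N + 1) g =
      Function.update (fillCells (s.iarr a) d N g) (d + N) (g N) := by
    funext j
    rcases eq_or_ne j (d + N) with rfl | hj
    · simp [fillCells]
    · simp only [fillCells, Function.update_of_ne hj]
      congr 1
      push_cast
      exact propext ⟨fun h => by omega, fun h => by omega⟩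
  simp [Mem.fill, Mem.setI, Mem.setIA, this]

end Lookup

namespace Mem.Bounded

variable {rs : F → ℕ} {V : ℕ} {s : Mem F}

theorem setI (hs : s.Bounded rs V) (r : ℕ) {v : ℤ} (hv : |v| ≤ V) :
    (s.setI r v).Bounded rs V := by
  refine ⟨fun r' => ?_, hs.iarr_le, hs.rvar_le, hs.rarr_le⟩
  rw [Mem.setI_ivar]
  split_ifs
  exacts [hv, hs.ivar_le r']

theorem setIA (hs : s.Bounded rs V) (a : ℕ) (i : ℤ) {v : ℤ} (hv : |v| ≤ V) :
    (s.setIA a i v).Bounded rs V := by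
  refine ⟨hs.ivar_le, fun b j => ?_, hs.rvar_le, hs.rarr_le⟩
  rw [Mem.setIA_iarr]
  split_ifs with h
  · rw [Function.update_apply]
    split_ifs
    exacts [hv, hs.iarr_le b j]
  · exact hs.iarr_le b j

theorem setRA (hs : s.Bounded rs V) (a : ℕ) (i : ℤ) {v : F} (hv : rs v ≤ V) :
    (s.setRA a i v).Bounded rs V := by
  refine ⟨hs.ivar_le, hs.iarr_le, hs.rvar_le, fun b j => ?_⟩
  rw [Mem.setRA_rarr]
  split_ifs with h
  · rw [Function.update_apply]
    split_ifs
    exacts [hv, hs.rarr_le b j]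
  · exact hs.rarr_le b j

theorem fill (hs : s.Bounded rs V) (a : ℕ) (d : ℤ) {N : ℕ} (hN : N ≤ V) {g : ℕ → ℤ}
    (hg : ∀ k < N, |g k| ≤ V) : (s.fill a d N g).Bounded rs V := by
  induction N with
  | zero => exact s.fill_zero a d g ▸ hs.setI _ (by simp)
  | succ N ih =>
    rw [Mem.fill_succ]
    refine ((ih (by omega) fun k hk => hg k (by omega)).setIA a _ (hg N (by omega))).setI _ ?_
    exact abs_le.2 ⟨by omega, by exact_mod_cast hN⟩

end Mem.Bounded

end Memory

/-! ### The cost of programs on bounded memories -/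

section Cost

/-- A factor by which the cost and the size of the value of an integer expression exceed the size
of the memory contents at most. -/
def IExp.weight : IExp → ℕ
  | .const c => 1 + intSize c
  | .var _ => 2
  | .arr _ idx => idx.weight + 2
  | .add e₁ e₂ => 2 * (e₁.weight + e₂.weight) + 1
  | .sub e₁ e₂ => 2 * (e₁.weight + e₂.weight) + 1
  | .mul e₁ e₂ => 2 * (e₁.weight + e₂.weight) + 1

/-- The analogue of `IExp.weight` for expressions with values in `F`, where `C` is the constant of
the size measure. -/
def RExp.weight (C : ℕ) : RExp → ℕ
  | .ofInt e => (C + 1) * e.weight + 1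
  | .var _ => 2
  | .arr _ idx => idx.weight + 2
  | .add e₁ e₂ => (C + 1) * (e₁.weight C + e₂.weight C) + 1
  | .sub e₁ e₂ => (C + 1) * (e₁.weight C + e₂.weight C) + 1
  | .mul e₁ e₂ => (C + 1) * (e₁.weight C + e₂.weight C) + 1

/-- A factor by which the cost of a test exceeds the size of the memory contents at most. -/
def BExp.weight (C : ℕ) : BExp → ℕ
  | .leI e₁ e₂ => e₁.weight + e₂.weight + 1
  | .leR e₁ e₂ => e₁.weight C + e₂.weight C + 1
  | .not b => b.weight C + 1
  | .and b₁ b₂ => b₁.weight C + b₂.weight C + 1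

open Polynomial in
/-- The value at `V` of this polynomial bounds the cost of a run of the program during which the
memory contents have size at most `V` and each loop is executed at most `V` times in a row. -/
noncomputable def Prog.costBound (C : ℕ) : Prog → ℕ[X]
  | .skip => 1
  | .setIVar _ e => (e.weight + 1) • (X + 1)
  | .setIArr _ idx e => (idx.weight + e.weight + 1) • (X + 1)
  | .setRVar _ e => (e.weight C + 1) • (X + 1)
  | .setRArr _ idx e => (idx.weight + e.weight C + 1) • (X + 1)
  | .seq p q => p.costBound C + q.costBound C
  | .ite b p q => (b.weight C + 1) • (X + 1) + p.costBound C + q.costBound C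
  | .loop b p => (X + 1) * ((b.weight C + 1) • (X + 1) + p.costBound C)

variable {F : Type} {rs : F → ℕ} {C V : ℕ} {s : Mem F}

theorem IExp.size_val_and_cost_le (hs : s.Bounded rs V) (e : IExp) :
    intSize (e.val s) ≤ e.weight * (V + 1) ∧ e.cost s ≤ e.weight * (V + 1) := by
  induction e with simp only [IExp.val, IExp.cost, IExp.weight]
  | const c => constructor <;> nlinarith
  | var r =>
    have := intSize_le_of_abs_le (hs.ivar_le r)
    omega
  | arr a idx ih =>
    have := intSize_le_of_abs_le (hs.iarr_le a (idx.val s))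
    constructor <;> nlinarith
  | add e₁ e₂ ih₁ ih₂ =>
    have := intSize_add_le (e₁.val s) (e₂.val s)
    constructor <;> nlinarith
  | sub e₁ e₂ ih₁ ih₂ =>
    have := intSize_sub_le (e₁.val s) (e₂.val s)
    constructor <;> nlinarith
  | mul e₁ e₂ ih₁ ih₂ =>
    have := intSize_mul_le (e₁.val s) (e₂.val s)
    constructor <;> nlinarith

theorem IExp.cost_le (hs : s.Bounded rs V) (e : IExp) : e.cost s ≤ e.weight * (V + 1) :=
  (e.size_val_and_cost_le hs).2

variable [Ring F]

theorem RExp.size_val_and_cost_le (hC : IsSizeMeasure rs C) (hs : s.Bounded rs V) (e : RExp) :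
    rs (e.val s) ≤ e.weight C * (V + 1) ∧ e.cost rs s ≤ e.weight C * (V + 1) := by
  induction e with simp only [RExp.val, RExp.cost, RExp.weight]
  | ofInt e =>
    have h₁ := hC.int_le (e.val s)
    have h₂ := e.size_val_and_cost_le hs
    have h₃ := Nat.mul_le_mul_left C h₂.1
    constructor <;> nlinarith
  | var r =>
    have := hs.rvar_le r
    omega
  | arr a idx =>
    have h₁ := hs.rarr_le a (idx.val s)
    have h₂ := idx.cost_le hs
    constructor <;> nlinarith
  | add e₁ e₂ ih₁ ih₂ =>
    have h₁ := hC.add_le (e₁.val s) (e₂.val s)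
    have h₂ := Nat.mul_le_mul_left C (Nat.add_le_add ih₁.1 ih₂.1)
    constructor <;> nlinarith
  | sub e₁ e₂ ih₁ ih₂ =>
    have h₁ := hC.sub_le (e₁.val s) (e₂.val s)
    have h₂ := Nat.mul_le_mul_left C (Nat.add_le_add ih₁.1 ih₂.1)
    constructor <;> nlinarith
  | mul e₁ e₂ ih₁ ih₂ =>
    have h₁ := hC.mul_le (e₁.val s) (e₂.val s)
    have h₂ := Nat.mul_le_mul_left C (Nat.add_le_add ih₁.1 ih₂.1)
    constructor <;> nlinarith

theorem RExp.cost_le (hC : IsSizeMeasure rs C) (hs : s.Bounded rs V) (e : RExp) :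
    e.cost rs s ≤ e.weight C * (V + 1) :=
  (e.size_val_and_cost_le hC hs).2

theorem BExp.cost_le (hC : IsSizeMeasure rs C) (hs : s.Bounded rs V) (b : BExp) :
    b.cost rs s ≤ b.weight C * (V + 1) := by
  induction b with simp only [BExp.cost, BExp.weight]
  | leI e₁ e₂ => nlinarith [e₁.cost_le hs, e₂.cost_le hs]
  | leR e₁ e₂ => nlinarith [e₁.cost_le hC hs, e₂.cost_le hC hs]
  | not b ih => nlinarith
  | and b₁ b₂ ih₁ ih₂ => nlinarith

end Cost

/-! ### Program logic -/

section Runs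

variable {F : Type} [Ring F] [LinearOrder F] {rs : F → ℕ} {C V : ℕ} {s : Mem F}
  {Q : Mem F → Prop}

/-- Total correctness with a cost bound: started with memory `s`, the program `P` halts with a
memory that satisfies `Q`, at a cost of at most the value of `P.costBound C` at `V`. -/
def Runs (rs : F → ℕ) (C V : ℕ) (P : Prog) (s : Mem F) (Q : Mem F → Prop) : Prop :=
  ∃ t s', Exec rs P s t s' ∧ t ≤ (P.costBound C).eval V ∧ Q s'

namespace Runs

theorem imp {P : Prog} {Q' : Mem F → Prop} (h : Runs rs C V P s Q) (hQ : ∀ s', Q s' → Q' s') :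
    Runs rs C V P s Q' :=
  let ⟨t, s', h₁, h₂, h₃⟩ := h
  ⟨t, s', h₁, h₂, hQ s' h₃⟩

theorem skip (h : Q s) : Runs rs C V .skip s Q :=
  ⟨_, _, .skip s, by simp [Prog.costBound], h⟩

theorem setIVar {r : ℕ} {e : IExp} {v : ℤ} (hs : s.Bounded rs V) (he : e.val s = v)
    (hv : |v| ≤ V) (h : (s.setI r v).Bounded rs V → Q (s.setI r v)) :
    Runs rs C V (.setIVar r e) s Q := by
  have : e.cost s + 1 ≤ (e.weight + 1) * (V + 1) := by nlinarith [e.cost_le hs]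
  subst he
  exact ⟨_, _, .setIVar r e s, by simpa [Prog.costBound, mul_add] using this, h (hs.setI r hv)⟩

theorem setIArr {a : ℕ} {idx e : IExp} {i v : ℤ} (hs : s.Bounded rs V) (hi : idx.val s = i)
    (he : e.val s = v) (hv : |v| ≤ V) (h : (s.setIA a i v).Bounded rs V → Q (s.setIA a i v)) :
    Runs rs C V (.setIArr a idx e) s Q := by
  have : idx.cost s + e.cost s + 1 ≤ (idx.weight + e.weight + 1) * (V + 1) := by
    nlinarith [e.cost_le hs, idx.cost_le hs]
  subst hi he
  exact ⟨_, _, .setIArr a idx e s, by simpa [Prog.costBound, mul_add] using this,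
    h (hs.setIA a _ hv)⟩

theorem setRArr {a : ℕ} {idx : IExp} {e : RExp} {i : ℤ} {v : F} (hC : IsSizeMeasure rs C)
    (hs : s.Bounded rs V) (hi : idx.val s = i) (he : e.val s = v) (hv : rs v ≤ V)
    (h : (s.setRA a i v).Bounded rs V → Q (s.setRA a i v)) :
    Runs rs C V (.setRArr a idx e) s Q := by
  have : idx.cost s + e.cost rs s + 1 ≤ (idx.weight + e.weight C + 1) * (V + 1) := by
    nlinarith [e.cost_le hC hs, idx.cost_le hs]
  subst hi he
  exact ⟨_, _, .setRArr a idx e s, by simpa [Prog.costBound, mul_add] using this,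
    h (hs.setRA a _ hv)⟩

theorem seq {p q : Prog} (h : Runs rs C V p s fun s' => Runs rs C V q s' Q) :
    Runs rs C V (.seq p q) s Q := by
  obtain ⟨t₁, s₁, h₁, ht₁, t₂, s₂, h₂, ht₂, hQ⟩ := h
  refine ⟨_, _, .seq h₁ h₂, ?_, hQ⟩
  simpa only [Prog.costBound, Polynomial.eval_add] using Nat.add_le_add ht₁ ht₂

theorem ite {b : BExp} {p q : Prog} (hC : IsSizeMeasure rs C) (hs : s.Bounded rs V)
    (hp : b.Holds s → Runs rs C V p s Q) (hq : ¬ b.Holds s → Runs rs C V q s Q) :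
    Runs rs C V (.ite b p q) s Q := by
  have hb : b.cost rs s + 1 ≤ (b.weight C + 1) * (V + 1) := by nlinarith [b.cost_le hC hs]
  have hcost : ((Prog.ite b p q).costBound C).eval V =
      (b.weight C + 1) * (V + 1) + (p.costBound C).eval V + (q.costBound C).eval V := by
    simp [Prog.costBound, mul_add]
  by_cases h : b.Holds s
  · obtain ⟨t, s', h₁, h₂, h₃⟩ := hp h
    exact ⟨_, _, .iteTrue h h₁, by omega, h₃⟩
  · obtain ⟨t, s', h₁, h₂, h₃⟩ := hq h
    exact ⟨_, _, .iteFalse h h₁, by omega, h₃⟩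

theorem loop {b : BExp} {p : Prog} {N : ℕ} (Inv : ℕ → Mem F → Prop) (hC : IsSizeMeasure rs C)
    (hN : N ≤ V) (h₀ : Inv 0 s)
    (htest : ∀ k s, k ≤ N → Inv k s → s.Bounded rs V ∧ (b.Holds s ↔ k < N))
    (hbody : ∀ k s, k < N → Inv k s → Runs rs C V p s (Inv (k + 1))) (hQ : ∀ s, Inv N s → Q s) :
    Runs rs C V (.loop b p) s Q := by
  set τ := (b.weight C + 1) * (V + 1) + (p.costBound C).eval V with hτ
  have test_cost {k s} (hk : k ≤ N) (hI : Inv k s) :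
      b.cost rs s + 1 ≤ (b.weight C + 1) * (V + 1) := by
    nlinarith [b.cost_le hC (htest k s hk hI).1]
  have rounds : ∀ m k s, k + m = N → Inv k s →
      ∃ t s', Exec rs (.loop b p) s t s' ∧ t ≤ (m + 1) * τ ∧ Inv N s' := by
    intro m
    induction m with
    | zero =>
      rintro k s rfl hI
      have hb := (htest k s le_rfl hI).2.not.2 (by simp)
      exact ⟨_, s, .loopDone hb, by have := test_cost le_rfl hI; omega, hI⟩
    | succ m ih =>
      intro k s hk hI
      have hb := (htest k s (by omega) hI).2.2 (by omega)
      obtain ⟨t₁, s₁, h₁, ht₁, hI₁⟩ := hbody k s (by omega) hI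
      obtain ⟨t₂, s₂, h₂, ht₂, hI₂⟩ := ih (k + 1) s₁ (by omega) hI₁
      refine ⟨_, s₂, .loopStep hb h₁ h₂, ?_, hI₂⟩
      have := test_cost (by omega) hI
      linarith
  obtain ⟨t, s', h₁, h₂, h₃⟩ := rounds N 0 s (by omega) h₀
  have hcost : ((Prog.loop b p).costBound C).eval V = (V + 1) * τ := by
    simp [Prog.costBound, hτ, mul_add]
  exact ⟨t, s', h₁, h₂.trans (hcost ▸ Nat.mul_le_mul_right τ (by omega)), hQ s' h₃⟩

end Runs

/-- `for r = 0, …, bound - 1 do body`. -/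
def forUp (r : ℕ) (bound : IExp) (body : Prog) : Prog :=
  .seq (.setIVar r (.const 0)) (.loop (.not (.leI bound (.var r)))
    (.seq body (.setIVar r (.add (.var r) (.const 1)))))

theorem Runs.forUp {r : ℕ} {bound : IExp} {body : Prog} {N : ℕ} (Inv : ℕ → Mem F → Prop)
    (hC : IsSizeMeasure rs C) (hs : s.Bounded rs V) (hN : N ≤ V) (h₀ : Inv 0 (s.setI r 0))
    (hInv : ∀ k s, k ≤ N → Inv k s → s.Bounded rs V ∧ s.ivar r = k ∧ bound.val s = N)
    (hbody : ∀ k s, k < N → Inv k s → Runs rs C V body s fun s' =>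
      s'.Bounded rs V ∧ s'.ivar r = k ∧ Inv (k + 1) (s'.setI r (k + 1 : ℕ)))
    (hQ : ∀ s, Inv N s → Q s) : Runs rs C V (forUp r bound body) s Q := by
  refine .seq (.setIVar hs rfl (v := 0) (by simp) fun _ =>
    .loop Inv hC hN h₀ (fun k s hk hI => ?_) (fun k s hk hI => ?_) hQ)
  · obtain ⟨hb, hr, hN⟩ := hInv k s hk hI
    simp [BExp.Holds, IExp.val, hb, hr, hN]
  · refine .seq ((hbody k s hk hI).imp fun s' ⟨hb, hr, hI'⟩ => ?_)
    refine .setIVar hb (v := (k + 1 : ℕ)) (by simp [IExp.val, hr]) ?_ fun _ => hI'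
    rw [Nat.abs_cast]
    exact_mod_cast hk.trans_le hN

/-- Writes the values of `e` to `len` consecutive cells of the integer array `a`, from cell
`base` on; `e` may refer to the loop counter. -/
def fillBlock (a : ℕ) (base len e : IExp) : Prog :=
  forUp fillReg len (.setIArr a (.add base (.var fillReg)) e)

theorem Runs.fillBlock {a : ℕ} {base len e : IExp} {d : ℤ} {N : ℕ} {g : ℕ → ℤ}
    (hC : IsSizeMeasure rs C) (hs : s.Bounded rs V) (hN : N ≤ V) (hg : ∀ k < N, |g k| ≤ V)
    (hlen : ∀ k ≤ N, len.val (s.fill a d k g) = N)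
    (hval : ∀ k < N, base.val (s.fill a d k g) = d ∧ e.val (s.fill a d k g) = g k)
    (hQ : (s.fill a d N g).Bounded rs V → Q (s.fill a d N g)) :
    Runs rs C V (fillBlock a base len e) s Q := by
  have bounded {k} (hk : k ≤ N) : (s.fill a d k g).Bounded rs V :=
    hs.fill a d (hk.trans hN) fun j hj => hg j (hj.trans_le hk)
  refine .forUp (fun k s' => s' = s.fill a d k g) hC hs hN (Mem.fill_zero ..).symm ?_ ?_
    (fun _ h => h ▸ hQ (bounded le_rfl))
  · rintro k _ hk rfl
    exact ⟨bounded hk, by simp, hlen k hk⟩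
  · rintro k _ hk rfl
    obtain ⟨hbase, he⟩ := hval k hk
    refine .setIArr (bounded hk.le) (i := d + k) (by simp [IExp.val, hbase]) he (hg k hk)
      fun hb => ⟨hb, by simp, ?_⟩
    simp [Mem.fill_succ]

end Runs

/-! ### Sizes of real and rational numbers -/

theorem isSizeMeasure_realSize : IsSizeMeasure realSize 1 where
  int_le z := by simpa [realSize] using one_le_intSize z
  add_le _ _ := by simp [realSize]
  sub_le _ _ := by simp [realSize]
  mul_le _ _ := by simp [realSize]
  sum_le _ _ := by simp [realSize]

theorem intSize_add_le_max (a b : ℤ) : intSize (a + b) ≤ max (intSize a) (intSize b) + 1 := by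
  have h₁ := Nat.size_le_size (Int.natAbs_add_le a b)
  have h₂ := natSize_add_le a.natAbs b.natAbs
  unfold intSize
  omega

theorem intSize_mul_natCast_le (a : ℤ) (b : ℕ) : intSize (a * b) ≤ intSize a + Nat.size b := by
  have := natSize_mul_le a.natAbs b
  simp only [intSize, Int.natAbs_mul, Int.natAbs_natCast]
  omega

theorem ratSize_neg (q : ℚ) : ratSize (-q) = ratSize q := by
  simp [ratSize, intSize]

theorem ratSize_intCast (z : ℤ) : ratSize z = intSize z + 1 := by
  simp [ratSize]

theorem ratSize_div_le (a : ℤ) {b : ℕ} (hb : b ≠ 0) :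
    ratSize (a / b) ≤ intSize a + Nat.size b := by
  have hq : (a / b : ℚ) = Rat.divInt a b := by simp [Rat.divInt_eq_div]
  have hden : (a / b : ℚ).den ∣ b := by
    exact_mod_cast hq ▸ Rat.den_dvd a b
  have hnum : (a / b : ℚ).num.natAbs ≤ a.natAbs := by
    rcases eq_or_ne a 0 with rfl | ha
    · simp
    · have : (a / b : ℚ).num ∣ a := hq ▸ Rat.num_dvd a (by exact_mod_cast hb)
      exact Nat.le_of_dvd (by omega) (Int.natAbs_dvd_natAbs.2 this)
  exact Nat.add_le_add (Nat.add_le_add_right (Nat.size_le_size hnum) 1)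
    (Nat.size_le_size (Nat.le_of_dvd (by omega) hden))

theorem ratSize_add_le (p q : ℚ) : ratSize (p + q) ≤ 2 * (ratSize p + ratSize q) := by
  have h : p + q = (p.num * q.den + q.num * p.den : ℤ) / (p.den * q.den : ℕ) := by
    have h₁ : (p.den : ℚ) ≠ 0 := by exact_mod_cast p.den_nz
    have h₂ : (q.den : ℚ) ≠ 0 := by exact_mod_cast q.den_nz
    conv_lhs => rw [← Rat.num_div_den p, ← Rat.num_div_den q]
    push_cast
    field_simp
  have hdiv := h ▸ ratSize_div_le _ (Nat.mul_ne_zero p.den_nz q.den_nz)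
  have hadd := intSize_add_le (p.num * q.den) (q.num * p.den)
  have hnum₁ := intSize_mul_natCast_le p.num q.den
  have hnum₂ := intSize_mul_natCast_le q.num p.den
  have hden := natSize_mul_le p.den q.den
  unfold ratSize at hdiv ⊢
  omega

theorem ratSize_mul_le (p q : ℚ) : ratSize (p * q) ≤ 2 * (ratSize p + ratSize q) := by
  have h : p * q = (p.num * q.num : ℤ) / (p.den * q.den : ℕ) := by
    conv_lhs => rw [← Rat.num_div_den p, ← Rat.num_div_den q]
    push_cast
    rw [div_mul_div_comm]
  have hdiv := h ▸ ratSize_div_le _ (Nat.mul_ne_zero p.den_nz q.den_nz)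
  have hnum := intSize_mul_le p.num q.num
  have hden := natSize_mul_le p.den q.den
  unfold ratSize at hdiv ⊢
  omega

theorem exists_sum_eq_div {ι : Type} (t : Finset ι) (g : ι → ℚ) :
    ∃ (a : ℤ) (b : ℕ), b ≠ 0 ∧ ∑ i ∈ t, g i = a / b ∧
      intSize a ≤ 1 + ∑ i ∈ t, ratSize (g i) ∧ Nat.size b ≤ 1 + ∑ i ∈ t, ratSize (g i) := by
  classical
  induction t using Finset.induction_on with
  | empty => exact ⟨0, 1, by simp, by simp, by simp [intSize], by simp⟩
  | insert i t hi ih =>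
    obtain ⟨a, b, hb, hsum, ha, hb'⟩ := ih
    have hsize : ratSize (g i) = intSize (g i).num + Nat.size (g i).den := rfl
    have hden : 1 ≤ Nat.size (g i).den := Nat.size_pos.2 (g i).den_pos
    refine ⟨(g i).num * b + a * (g i).den, (g i).den * b, Nat.mul_ne_zero (g i).den_nz hb, ?_⟩
    simp only [Finset.sum_insert hi]
    refine ⟨?_, ?_, ?_⟩
    · have h₁ : ((g i).den : ℚ) ≠ 0 := by exact_mod_cast (g i).den_nz
      have h₂ : (b : ℚ) ≠ 0 := by exact_mod_cast hb
      rw [hsum]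
      conv_lhs => rw [← Rat.num_div_den (g i)]
      push_cast
      field_simp
    · have h₁ := intSize_add_le_max ((g i).num * b) (a * (g i).den)
      have h₂ := intSize_mul_natCast_le (g i).num b
      have h₃ := intSize_mul_natCast_le a (g i).den
      have h₄ := one_le_intSize (g i).num
      omega
    · have := natSize_mul_le (g i).den b
      omega

theorem ratSize_sum_le {ι : Type} (t : Finset ι) (g : ι → ℚ) :
    ratSize (∑ i ∈ t, g i) ≤ 2 * (1 + ∑ i ∈ t, ratSize (g i)) := by
  obtain ⟨a, b, hb, hsum, ha, hb'⟩ := exists_sum_eq_div t g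
  have := hsum ▸ ratSize_div_le a hb
  omega

theorem isSizeMeasure_ratSize : IsSizeMeasure ratSize 2 where
  int_le z := by
    have := one_le_intSize z
    have := ratSize_intCast z
    omega
  add_le := ratSize_add_le
  sub_le p q := by simpa [sub_eq_add_neg, ratSize_neg] using ratSize_add_le p (-q)
  mul_le := ratSize_mul_le
  sum_le := ratSize_sum_le

/-! ### Keys of solutions -/

section Keys

theorem bit_nonneg {n : ℕ} (x : Sol n) (i : Fin n) : 0 ≤ bit x i := by
  unfold bit; split_ifs <;> simp

theorem bit_le_one {n : ℕ} (x : Sol n) (i : Fin n) : bit x i ≤ 1 := by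
  unfold bit; split_ifs <;> simp

theorem bit_update_true {n : ℕ} (x : Sol n) (k i : Fin n) :
    bit (Function.update x k true) i = if i = k then 1 else bit x i := by
  rcases eq_or_ne i k with rfl | h <;> simp [bit, *]

theorem sumObj_false {F : Type} [Ring F] {n : ℕ} (f : Fin n → F) :
    sumObj f (fun _ => false) = 0 := by
  simp [sumObj, bit]

theorem sumObj_update {F : Type} [Ring F] {n : ℕ} (f : Fin n → F) {x : Sol n} {k : Fin n}
    (hk : x k = false) : sumObj f (Function.update x k true) = sumObj f x + f k := by
  have summand (i : Fin n) : f i * (bit (Function.update x k true) i : F) =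
      f i * (bit x i : F) + if i = k then f k else 0 := by
    rcases eq_or_ne i k with rfl | h
    · simp [bit, hk]
    · simp [bit_update_true, h]
  simp [sumObj, summand, Finset.sum_add_distrib]

theorem sumObj_eq_sum_filter {F : Type} [Ring F] {n : ℕ} (f : Fin n → F) (x : Sol n) :
    sumObj f x = ∑ i with x i = true, f i := by
  rw [sumObj, Finset.sum_filter]
  refine Finset.sum_congr rfl fun i _ => ?_
  by_cases h : x i <;> simp [bit, h]

namespace Inst

variable {F : Type} [Zero F] [LE F] {Kt Kh n : ℕ}

/-- The contribution of element `i` to component `j`, where the components are the two incremental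
counting vectors, in positions `0, …, Kt - 1` and `Kt, …, Kt + Kh - 1`, followed by the
cardinality. -/
def entry (I : Inst F Kt Kh n) (i : Fin n) (j : ℕ) : ℤ :=
  if j < Kt then (if j ≤ (I.catT i : ℕ) then 1 else 0)
  else if j < Kt + Kh then (if j - Kt ≤ (I.catH i : ℕ) then 1 else 0) else 1

/-- Component `j` of a solution: an entry of one of the counting vectors, or the cardinality. -/
def comp (I : Inst F Kt Kh n) (x : Sol n) (j : ℕ) : ℤ :=
  sumObj (fun i => I.entry i j) x

/-- The contribution of an element to the keys of the solutions that contain it. -/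
def elemKey (I : Inst F Kt Kh n) (i : Fin n) : ℤ :=
  ∑ j ∈ Finset.range (Kt + Kh + 1), I.entry i j * ((n : ℤ) + 1) ^ j

/-- The number whose digits to the base `n + 1` are the components of `x`. -/
def key (I : Inst F Kt Kh n) (x : Sol n) : ℤ :=
  ∑ j ∈ Finset.range (Kt + Kh + 1), I.comp x j * ((n : ℤ) + 1) ^ j

variable (I : Inst F Kt Kh n) (x : Sol n)

theorem entry_mem_Icc (i : Fin n) (j : ℕ) : I.entry i j ∈ Set.Icc 0 1 := by
  unfold entry; split_ifs <;> simp

theorem comp_false (j : ℕ) : I.comp (fun _ => false) j = 0 :=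
  sumObj_false _

theorem key_false : I.key (fun _ => false) = 0 := by
  simp [key, I.comp_false]

variable {x} in
theorem comp_update {k : Fin n} (hk : x k = false) (j : ℕ) :
    I.comp (Function.update x k true) j = I.comp x j + I.entry k j :=
  sumObj_update _ hk

variable {x} in
theorem key_update {k : Fin n} (hk : x k = false) :
    I.key (Function.update x k true) = I.key x + I.elemKey k := by
  simp [key, elemKey, I.comp_update hk, add_mul, Finset.sum_add_distrib]

theorem comp_eq_sum (j : ℕ) : I.comp x j = ∑ i, I.entry i j * bit x i := by
  simp [comp, sumObj]

theorem comp_nonneg (j : ℕ) : 0 ≤ I.comp x j := by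
  rw [comp_eq_sum]
  exact Finset.sum_nonneg fun i _ => mul_nonneg (I.entry_mem_Icc i j).1 (bit_nonneg x i)

theorem comp_le (j : ℕ) : I.comp x j ≤ n := by
  calc I.comp x j = ∑ i, I.entry i j * bit x i := I.comp_eq_sum x j
    _ ≤ ∑ _i : Fin n, (1 : ℤ) := Finset.sum_le_sum fun i _ =>
        mul_le_one₀ (I.entry_mem_Icc i j).2 (bit_nonneg x i) (bit_le_one x i)
    _ = n := by simp

/-- The components of a solution as digits to the base `n + 1`. -/
def digits (j : Fin (Kt + Kh + 1)) : Fin (n + 1) :=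
  ⟨(I.comp x j).toNat, by have := I.comp_le x j; omega⟩

theorem key_eq_digits : I.key x = (finFunctionFinEquiv (I.digits x) : ℕ) := by
  rw [finFunctionFinEquiv_apply, key, Finset.sum_range]
  push_cast
  refine Finset.sum_congr rfl fun j _ => ?_
  simp [digits, I.comp_nonneg x j]

theorem key_nonneg : 0 ≤ I.key x := by
  rw [key_eq_digits]; positivity

theorem key_lt : I.key x < ((n : ℤ) + 1) ^ (Kt + Kh + 1) := by
  rw [key_eq_digits]
  exact_mod_cast (finFunctionFinEquiv (I.digits x)).2

variable {x} in
theorem comp_eq_of_key_eq {y : Sol n} (h : I.key x = I.key y) {j : ℕ} (hj : j < Kt + Kh + 1) :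
    I.comp x j = I.comp y j := by
  rw [key_eq_digits, key_eq_digits, Nat.cast_inj, Fin.val_inj,
    EmbeddingLike.apply_eq_iff_eq] at h
  have hdigit := congrArg Fin.val (congrFun h ⟨j, hj⟩)
  have hx := I.comp_nonneg x j
  have hy := I.comp_nonneg y j
  simp only [digits] at hdigit
  omega

theorem elemKey_eq_key (i : Fin n) :
    I.elemKey i = I.key (Function.update (fun _ => false) i true) := by
  simp [I.key_update, I.key_false]

theorem elemKey_pos (i : Fin n) : 0 < I.elemKey i := by
  have hterm : I.entry i (Kt + Kh) * ((n : ℤ) + 1) ^ (Kt + Kh) ≤ I.elemKey i :=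
    Finset.single_le_sum (f := fun j => I.entry i j * ((n : ℤ) + 1) ^ j)
      (fun j _ => mul_nonneg (I.entry_mem_Icc i j).1 (by positivity)) (by simp)
  have hlast : I.entry i (Kt + Kh) = 1 := by simp [entry]
  have hpow : (0 : ℤ) < ((n : ℤ) + 1) ^ (Kt + Kh) := by positivity
  rw [hlast, one_mul] at hterm
  exact hpow.trans_le hterm

theorem countVec_catT (j : Fin Kt) : countVec I.catT x j = I.comp x j := by
  have hentry (i : Fin n) : I.entry i j = costEntry I.catT i j := if_pos j.2
  simp only [countVec, comp_eq_sum, hentry]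

theorem countVec_catH (j : Fin Kh) : countVec I.catH x j = I.comp x (Kt + j) := by
  have hentry (i : Fin n) : I.entry i (Kt + j) = costEntry I.catH i j := by
    rw [entry, if_neg (by lia), if_pos (by lia), Nat.add_sub_cancel_left, costEntry]
    rfl
  simp only [countVec, comp_eq_sum, hentry]

theorem sum_bit : ∑ i, bit x i = I.comp x (Kt + Kh) := by
  simp [comp_eq_sum, entry]

end Inst

end Keys

/-! ### The dynamic program -/

section KeyClass

namespace Inst

variable {F : Type} [Ring F] [LinearOrder F] {Kt Kh n : ℕ} (I : Inst F Kt Kh n) {k : ℕ} {q : ℤ}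

/-- The solutions with key `q` that select only elements among the first `k`. -/
def keyClass (k : ℕ) (q : ℤ) : Set (Sol n) :=
  {x | (∀ i : Fin n, k ≤ i → x i = false) ∧ I.key x = q}

theorem keyClass_zero (q : ℤ) : I.keyClass 0 q = {x | x = (fun _ => false) ∧ q = 0} := by
  ext x
  constructor
  · rintro ⟨hx, rfl⟩
    obtain rfl : x = fun _ => false := funext fun i => hx i i.1.zero_le
    exact ⟨rfl, I.key_false⟩
  · rintro ⟨rfl, rfl⟩
    exact ⟨fun _ _ => rfl, I.key_false⟩

theorem keyClass_succ (k : Fin n) (q : ℤ) : I.keyClass (k + 1) q =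
    I.keyClass k q ∪ (Function.update · k true) '' I.keyClass k (q - I.elemKey k) := by
  ext x
  constructor
  · rintro ⟨hx, hq⟩
    cases hk : x k with
    | false =>
      refine .inl ⟨fun i hi => ?_, hq⟩
      rcases eq_or_ne i k with rfl | hne
      exacts [hk, hx i (by have := Fin.val_ne_of_ne hne; omega)]
    | true =>
      have hupd : Function.update (Function.update x k false) k true = x := by simp [← hk]
      refine .inr ⟨Function.update x k false, ⟨fun i hi => ?_, ?_⟩, hupd⟩
      · rcases eq_or_ne i k with rfl | hne
        · simp
        · simpa [hne] using hx i (by have := Fin.val_ne_of_ne hne; omega)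
      · rw [← hq, ← congrArg I.key hupd, I.key_update (by simp), add_sub_cancel_right]
  · rintro (⟨hx, hq⟩ | ⟨y, ⟨hy, hq⟩, rfl⟩)
    · exact ⟨fun i hi => hx i (by omega), hq⟩
    · refine ⟨fun i hi => ?_, by rw [I.key_update (hy k le_rfl), hq, sub_add_cancel]⟩
      have : i ≠ k := by rintro rfl; omega
      simpa [this] using hy i (by omega)

theorem mem_keyClass_key (x : Sol n) : x ∈ I.keyClass n (I.key x) :=
  ⟨fun i hi => absurd i.2 (by omega), rfl⟩

/-- `x` minimizes `γ f` among the solutions with key `q` that select only elements among the first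
`k`. -/
def IsBest (γ : ℤ) (k : ℕ) (q : ℤ) (x : Sol n) : Prop :=
  x ∈ I.keyClass k q ∧ ∀ y ∈ I.keyClass k q, (γ : F) * sumObj I.f x ≤ γ * sumObj I.f y

variable {I} {γ : ℤ} {x y : Sol n}

theorem IsBest.sumObj_update {k : Fin n} (hy : I.IsBest γ k q y) :
    sumObj I.f (Function.update y k true) = sumObj I.f y + I.f k :=
  OrdMUCO.sumObj_update _ (hy.1.1 k le_rfl)

theorem IsBest.keep {k : Fin n} (hx : I.IsBest γ k q x)
    (h : ∀ z ∈ I.keyClass k (q - I.elemKey k),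
      (γ : F) * sumObj I.f x ≤ γ * sumObj I.f (Function.update z k true)) :
    I.IsBest γ (k + 1) q x := by
  unfold IsBest
  rw [keyClass_succ]
  refine ⟨.inl hx.1, ?_⟩
  rintro _ (hz | ⟨z, hz, rfl⟩)
  exacts [hx.2 _ hz, h z hz]

variable [IsOrderedAddMonoid F]

theorem IsBest.update_le {k : Fin n} {z : Sol n} (hy : I.IsBest γ k q y)
    (hz : z ∈ I.keyClass k q) : (γ : F) * sumObj I.f (Function.update y k true) ≤
      γ * sumObj I.f (Function.update z k true) := by
  rw [hy.sumObj_update, OrdMUCO.sumObj_update _ (hz.1 k le_rfl), mul_add, mul_add]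
  exact add_le_add_left (hy.2 z hz) _

theorem IsBest.take {k : Fin n} (hy : I.IsBest γ k (q - I.elemKey k) y)
    (h : ∀ z ∈ I.keyClass k q,
      (γ : F) * sumObj I.f (Function.update y k true) ≤ γ * sumObj I.f z) :
    I.IsBest γ (k + 1) q (Function.update y k true) := by
  unfold IsBest
  rw [keyClass_succ]
  refine ⟨.inr ⟨y, hy.1, rfl⟩, ?_⟩
  rintro _ (hz | ⟨z, hz, rfl⟩)
  exacts [h _ hz, hy.update_le hz]

end Inst

end KeyClass

/-! ### Selection of a minimal complete set -/

section Selection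

section PartialOrder

variable {P : Type} [PartialOrder P] {A : Set ℕ} {Z : ℕ → P} {p q M : ℕ}

/-- The value with index `p` is a reason to discard the one with index `q`: it is smaller, or equal
with a smaller index. -/
def Beats (Z : ℕ → P) (p q : ℕ) : Prop :=
  Z p ≤ Z q ∧ ¬ (Z q ≤ Z p ∧ q ≤ p)

/-- The indices in `A` that no index in `A` beats: the first index of each minimal value. -/
def kept (A : Set ℕ) (Z : ℕ → P) : Set ℕ :=
  {q | q ∈ A ∧ ∀ p ∈ A, ¬ Beats Z p q}

theorem injOn_kept (A : Set ℕ) (Z : ℕ → P) : Set.InjOn Z (kept A Z) := by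
  intro p hp q hq h
  have hpq := hp.2 q hq.1
  have hqp := hq.2 p hp.1
  simp only [Beats, h, le_refl, true_and, not_not] at hpq hqp
  omega

open Classical in
/-- The list of the kept indices below `M`, in increasing order. -/
noncomputable def keptBelow (A : Set ℕ) (Z : ℕ → P) (M : ℕ) : List ℕ :=
  (List.range M).filter (· ∈ kept A Z)

theorem keptBelow_succ_of_mem (h : M ∈ kept A Z) :
    keptBelow A Z (M + 1) = keptBelow A Z M ++ [M] := by
  simp [keptBelow, List.range_succ, h]

theorem keptBelow_succ_of_notMem (h : M ∉ kept A Z) :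
    keptBelow A Z (M + 1) = keptBelow A Z M := by
  simp [keptBelow, List.range_succ, h]

theorem mem_keptBelow : q ∈ keptBelow A Z M ↔ q < M ∧ q ∈ kept A Z := by
  simp [keptBelow]

theorem nodup_keptBelow (A : Set ℕ) (Z : ℕ → P) (M : ℕ) : (keptBelow A Z M).Nodup :=
  List.nodup_range.filter _

theorem length_keptBelow_le (A : Set ℕ) (Z : ℕ → P) (M : ℕ) : (keptBelow A Z M).length ≤ M :=
  (List.length_filter_le _ _).trans_eq List.length_range

end PartialOrder

variable {F : Type} [LinearOrder F] {Kt Kh n : ℕ} {X : Set (Sol n)}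
  {z : Sol n → Outcome F Kt Kh} {A : Set ℕ} {x : ℕ → Sol n}

/-- The solutions `x q`, `q ∈ A`, are feasible, and each feasible solution is weakly dominated by
one of them. -/
structure IsDominatingFamily (X : Set (Sol n)) (z : Sol n → Outcome F Kt Kh) (A : Set ℕ)
    (x : ℕ → Sol n) : Prop where
  mem : ∀ q ∈ A, x q ∈ X
  exists_le : ∀ y ∈ X, ∃ q ∈ A, z (x q) ≤ z y

namespace IsDominatingFamily

theorem mem_efficientSet (h : IsDominatingFamily X z A x) {q : ℕ} (hq : q ∈ kept A (z ∘ x)) :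
    x q ∈ efficientSet X z := by
  refine ⟨h.mem q hq.1, ?_⟩
  rintro ⟨y, hy, hle, hne⟩
  obtain ⟨p, hp, hpy⟩ := h.exists_le y hy
  exact hq.2 p hp ⟨hpy.trans hle, fun hqp => hne (le_antisymm hle (hqp.1.trans hpy))⟩

theorem exists_kept (h : IsDominatingFamily X z A x) {v : Outcome F Kt Kh}
    (hv : v ∈ nondominatedSet X z) : ∃ q ∈ kept A (z ∘ x), z (x q) = v := by
  classical
  obtain ⟨y, ⟨hy, hyeff⟩, rfl⟩ := hv
  have eq_of_le {q} (hq : q ∈ A) (hle : z (x q) ≤ z y) : z (x q) = z y := by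
    by_contra hne
    exact hyeff ⟨x q, h.mem q hq, hle, hne⟩
  have hex : ∃ q, q ∈ A ∧ z (x q) = z y := by
    obtain ⟨q, hq, hle⟩ := h.exists_le y hy
    exact ⟨q, hq, eq_of_le hq hle⟩
  obtain ⟨hmem, heq⟩ := Nat.find_spec hex
  refine ⟨Nat.find hex, ⟨hmem, fun p hp hb => ?_⟩, heq⟩
  have hpeq := eq_of_le hp (hb.1.trans heq.le)
  exact hb.2 ⟨(heq.trans hpeq.symm).le, Nat.find_min' hex ⟨hp, hpeq⟩⟩

theorem nondominatedSet_eq (h : IsDominatingFamily X z A x) :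
    nondominatedSet X z = (z ∘ x) '' kept A (z ∘ x) := by
  refine Set.Subset.antisymm (fun v hv => h.exists_kept hv) ?_
  rintro _ ⟨q, hq, rfl⟩
  exact ⟨x q, h.mem_efficientSet hq, rfl⟩

theorem isMinimalComplete (h : IsDominatingFamily X z A x) :
    IsMinimalComplete X z (x '' kept A (z ∘ x)) := by
  refine ⟨?_, fun v hv => ?_⟩
  · rintro _ ⟨q, hq, rfl⟩
    exact h.mem_efficientSet hq
  · obtain ⟨q, hq, rfl⟩ := h.exists_kept hv
    refine ⟨x q, ⟨⟨q, hq, rfl⟩, rfl⟩, ?_⟩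
    rintro _ ⟨⟨p, hp, rfl⟩, heq⟩
    rw [injOn_kept A (z ∘ x) hp hq heq]

end IsDominatingFamily

end Selection

/-! ### Building the table -/

/-- The program expression for `(n + 1) ^ d`. -/
def powE : ℕ → IExp
  | 0 => .const 1
  | d + 1 => .mul (powE d) (.add (.var nReg) (.const 1))

/-- The program expression for the number with the digits `0, …, d - 1` of the current element. -/
def keyE : ℕ → IExp
  | 0 => .const 0
  | d + 1 => .add (keyE d) (.mul (.arr entryArr (.const d)) (powE d))

/-- Stores the entries of the current element. Category numbers in the input start from one, so
they are the numbers of leading ones in the two vectors of entries. -/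
def loadEntries (Kt Kh : ℕ) : Prog :=
  .seq (fillBlock entryArr (.const 0) (.const (Kt + Kh : ℕ)) (.const 0))
  (.seq (fillBlock entryArr (.const 0) (.arr catTArr (.var elemReg)) (.const 1))
  (.seq (fillBlock entryArr (.const Kt) (.arr catHArr (.var elemReg)) (.const 1))
  (.setIArr entryArr (.const (Kt + Kh : ℕ)) (.const 1))))

/-- The key of the row to whose solution the current element would be added. -/
def sourceE : IExp := .sub (.var rowReg) (.var shiftReg)

/-- Overwrites the current row with the solution in the source row, plus the current element. -/
def updateRow (Kt Kh : ℕ) : Prog :=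
  .seq (fillBlock bitsArr (.mul (.var rowReg) (.var nReg)) (.var nReg)
    (.arr bitsArr (.add (.mul sourceE (.var nReg)) (.var fillReg))))
  (.seq (.setIArr bitsArr (.add (.mul (.var rowReg) (.var nReg)) (.var elemReg)) (.const 1))
  (.seq (fillBlock compsArr (.mul (.var rowReg) (.const (Kt + Kh + 1 : ℕ)))
    (.const (Kt + Kh + 1 : ℕ))
    (.add (.arr compsArr (.add (.mul sourceE (.const (Kt + Kh + 1 : ℕ))) (.var fillReg)))
      (.arr entryArr (.var fillReg))))
  (.seq (.setRArr valueArr (.var rowReg)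
    (.add (.arr valueArr sourceE) (.arr coeffArr (.var elemReg))))
  (.setIArr flagArr (.var rowReg) (.const 1)))))

/-- The source row is occupied, and the current row is empty or not better than the source row
with the current element added. -/
def improveTest (γ : ℤ) : BExp :=
  .and (.leI (.const 1) (.arr flagArr sourceE))
    (.not (.and (.leI (.const 1) (.arr flagArr (.var rowReg)))
      (.not (.leR
        (.mul (.ofInt (.const γ)) (.add (.arr valueArr sourceE) (.arr coeffArr (.var elemReg))))
        (.mul (.ofInt (.const γ)) (.arr valueArr (.var rowReg)))))))

/-- Updates for the current element the row whose key is the number of rows not yet swept, minus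
one. -/
def sweepStep (Kt Kh : ℕ) (γ : ℤ) : Prog :=
  .seq (.setIVar rowReg (.sub (.sub (.var keysReg) (.const 1)) (.var sweepReg)))
    (.ite (improveTest γ) (updateRow Kt Kh) .skip)

/-- Updates all rows for the current element. The sweep is downwards so that each source row is
read before it is overwritten. -/
def addElement (Kt Kh : ℕ) (γ : ℤ) : Prog :=
  .seq (loadEntries Kt Kh) (.seq (.setIVar shiftReg (keyE (Kt + Kh + 1)))
    (forUp sweepReg (.var keysReg) (sweepStep Kt Kh γ)))

/-- The dynamic program, starting from the table whose only solution is the empty one. -/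
def buildTable (Kt Kh : ℕ) (γ : ℤ) : Prog :=
  .seq (.setIVar keysReg (powE (Kt + Kh + 1))) (.seq (.setIArr flagArr (.const 0) (.const 1))
    (forUp elemReg (.var nReg) (addElement Kt Kh γ)))

section Cells

variable {A : ℤ → ℤ} {d : ℤ} {N : ℕ} {v : ℕ → ℤ}

theorem fillCells_add {j : ℕ} (hj : j < N) : fillCells A d N v (d + j) = v j := by
  simp [fillCells, hj]

theorem fillCells_of_row_ne {q q' : ℤ} (hq : q' ≠ q) {m j : ℕ} (hm : m ≤ N) (hj : j < N) :
    fillCells A (q * N) m v (q' * N + j) = A (q' * N + j) := by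
  refine if_neg ?_
  rintro ⟨h₁, h₂⟩
  rcases hq.lt_or_gt with h | h <;> nlinarith

theorem mul_add_ne_of_ne {q q' : ℤ} (hq : q' ≠ q) {i j : ℕ} (hi : i < N) (hj : j < N) :
    q' * N + i ≠ q * N + j := by
  intro h
  rcases hq.lt_or_gt with h' | h' <;> nlinarith

end Cells

theorem toArray_coe {A : Type} [Zero A] {n : ℕ} (v : Fin n → A) (i : Fin n) :
    toArray v (i : ℤ) = v i := by
  simp [toArray]

section Rows

variable {F : Type} [Ring F] [LinearOrder F] {Kt Kh n : ℕ} {I : Inst F Kt Kh n}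
  {A A' : ℕ → ℤ → ℤ} {B B' : ℕ → ℤ → F} {q : ℤ} {x : Sol n} {γ : ℤ}

/-- The number of keys. -/
def numKeys (Kt Kh n : ℕ) : ℕ := (n + 1) ^ (Kt + Kh + 1)

/-- Row `q` of the table in the integer arrays `A` and the `F`-arrays `B` holds the solution `x`. -/
structure IsRow (I : Inst F Kt Kh n) (A : ℕ → ℤ → ℤ) (B : ℕ → ℤ → F) (q : ℤ) (x : Sol n) :
    Prop where
  flag_eq : A flagArr q = 1
  bits_eq : ∀ i : Fin n, A bitsArr (q * n + (i : ℕ)) = bit x i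
  comps_eq : ∀ j < Kt + Kh + 1, A compsArr (q * (Kt + Kh + 1 : ℕ) + j) = I.comp x j
  value_eq : B valueArr q = sumObj I.f x

/-- Row `q` holds a best solution among those with key `q` that select only elements among the
first `k`, or is empty if there is no such solution. -/
def RowCorrect (γ : ℤ) (I : Inst F Kt Kh n) (k : ℕ) (A : ℕ → ℤ → ℤ) (B : ℕ → ℤ → F) (q : ℤ) :
    Prop :=
  (A flagArr q = 0 ∧ I.keyClass k q = ∅) ∨ ∃ x, IsRow I A B q x ∧ I.IsBest γ k q x

/-- The arrays `A`, `B` and `A'`, `B'` agree in row `q` of the table. -/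
structure SameRow (Kt Kh n : ℕ) (A : ℕ → ℤ → ℤ) (B : ℕ → ℤ → F) (A' : ℕ → ℤ → ℤ)
    (B' : ℕ → ℤ → F) (q : ℤ) : Prop where
  flag_eq : A' flagArr q = A flagArr q
  bits_eq : ∀ i < n, A' bitsArr (q * n + i) = A bitsArr (q * n + i)
  comps_eq : ∀ j < Kt + Kh + 1, A' compsArr (q * (Kt + Kh + 1 : ℕ) + j) =
    A compsArr (q * (Kt + Kh + 1 : ℕ) + j)
  value_eq : B' valueArr q = B valueArr q

theorem IsRow.congr (h : IsRow I A B q x) (hs : SameRow Kt Kh n A B A' B' q) :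
    IsRow I A' B' q x where
  flag_eq := hs.flag_eq.trans h.flag_eq
  bits_eq i := (hs.bits_eq i i.2).trans (h.bits_eq i)
  comps_eq j hj := (hs.comps_eq j hj).trans (h.comps_eq j hj)
  value_eq := hs.value_eq.trans h.value_eq

theorem RowCorrect.congr {k : ℕ} (h : RowCorrect γ I k A B q)
    (hs : SameRow Kt Kh n A B A' B' q) : RowCorrect γ I k A' B' q := by
  rcases h with ⟨h₁, h₂⟩ | ⟨x, h₁, h₂⟩
  exacts [.inl ⟨hs.flag_eq.trans h₁, h₂⟩, .inr ⟨x, h₁.congr hs, h₂⟩]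

theorem Inst.keyClass_eq_empty {k : ℕ} (hq : q ∉ Set.Ico 0 (numKeys Kt Kh n : ℤ)) :
    I.keyClass k q = ∅ := by
  refine Set.eq_empty_of_forall_notMem fun x hx => hq ?_
  rw [← hx.2]
  exact ⟨I.key_nonneg x, by simpa [numKeys] using I.key_lt x⟩

theorem RowCorrect.of_notMem {k l : ℕ} (h : RowCorrect γ I k A B q)
    (hq : q ∉ Set.Ico 0 (numKeys Kt Kh n : ℤ)) : RowCorrect γ I l A B q := by
  rcases h with ⟨h₁, -⟩ | ⟨x, -, hx, -⟩
  · exact .inl ⟨h₁, Inst.keyClass_eq_empty hq⟩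
  · exact absurd hx (by simp [Inst.keyClass_eq_empty hq])

variable [IsOrderedAddMonoid F]

theorem RowCorrect.keep {k : Fin n} (hsrc : RowCorrect γ I k A B (q - I.elemKey k))
    (hrow : RowCorrect γ I k A B q)
    (htest : ¬ (1 ≤ A flagArr (q - I.elemKey k) ∧ (1 ≤ A flagArr q →
      (γ : F) * (B valueArr (q - I.elemKey k) + I.f k) ≤ γ * B valueArr q))) :
    RowCorrect γ I (k + 1) A B q := by
  rcases hsrc with ⟨-, hempty⟩ | ⟨y, hy, hybest⟩
  · rcases hrow with ⟨h₁, h₂⟩ | ⟨x, hx, hxbest⟩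
    · exact .inl ⟨h₁, by simp [I.keyClass_succ, h₂, hempty]⟩
    · exact .inr ⟨x, hx, hxbest.keep (by simp [hempty])⟩
  · simp only [hy.flag_eq, le_refl, true_and, Classical.not_imp, not_le] at htest
    obtain ⟨hflag, hlt⟩ := htest
    rcases hrow with ⟨h₁, -⟩ | ⟨x, hx, hxbest⟩
    · omega
    · rw [hx.value_eq, hy.value_eq, ← hybest.sumObj_update] at hlt
      exact .inr ⟨x, hx, hxbest.keep fun z hz => hlt.le.trans (hybest.update_le hz)⟩

theorem RowCorrect.take {k : Fin n} {y : Sol n} (hy : IsRow I A B (q - I.elemKey k) y)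
    (hybest : I.IsBest γ k (q - I.elemKey k) y) (hrow : RowCorrect γ I k A B q)
    (htest : 1 ≤ A flagArr q →
      (γ : F) * (B valueArr (q - I.elemKey k) + I.f k) ≤ γ * B valueArr q)
    (hnew : IsRow I A' B' q (Function.update y k true)) : RowCorrect γ I (k + 1) A' B' q := by
  refine .inr ⟨_, hnew, hybest.take fun z hz => ?_⟩
  rcases hrow with ⟨-, h⟩ | ⟨x, hx, hxbest⟩
  · simp [h] at hz
  · rw [hybest.sumObj_update, ← hy.value_eq]
    refine (htest hx.flag_eq.ge).trans ?_
    rw [hx.value_eq]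
    exact hxbest.2 z hz

end Rows

section Build

variable {F : Type} [Ring F] [LinearOrder F] {Kt Kh n w : ℕ} {rs : F → ℕ} {C V : ℕ}
  {I : Inst F Kt Kh n} {s : Mem F} {k : Fin n} {q : ℤ} {γ : ℤ}

theorem powE_val {F : Type} (s : Mem F) (d : ℕ) : (powE d).val s = (s.ivar nReg + 1) ^ d := by
  induction d with
  | zero => simp [powE, IExp.val]
  | succ d ih => simp [powE, IExp.val, ih, pow_succ]

theorem keyE_val {F : Type} (s : Mem F) (d : ℕ) :
    (keyE d).val s = ∑ j ∈ Finset.range d, s.iarr entryArr j * (s.ivar nReg + 1) ^ j := by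
  induction d with
  | zero => rfl
  | succ d ih => simp [keyE, IExp.val, ih, powE_val, Finset.sum_range_succ]

/-- All quantities that occur in the table have size at most `V`. -/
structure TableFits (rs : F → ℕ) (V : ℕ) (I : Inst F Kt Kh n) : Prop where
  keys_le : numKeys Kt Kh n + Kt + Kh ≤ V
  sumObj_le : ∀ x, rs (sumObj I.f x) ≤ V

/-- The memory holds the input, the number of keys and an empty output list. -/
structure BuildEnv (rs : F → ℕ) (V : ℕ) (I : Inst F Kt Kh n) (w : ℕ) (s : Mem F) : Prop where
  bounded : s.Bounded rs V
  n_eq : s.ivar nReg = n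
  w_eq : s.ivar wReg = w
  keys_eq : s.ivar keysReg = numKeys Kt Kh n
  count_eq : s.ivar countReg = 0
  catT_eq : ∀ i : Fin n, s.iarr catTArr (i : ℕ) = (I.catT i : ℕ) + 1
  catH_eq : ∀ i : Fin n, s.iarr catHArr (i : ℕ) = (I.catH i : ℕ) + 1
  coeff_eq : ∀ i : Fin n, s.rarr coeffArr (i : ℕ) = I.f i

/-- In addition, the memory holds the number, the key and the entries of the element `k`. -/
structure ElemEnv (rs : F → ℕ) (V : ℕ) (I : Inst F Kt Kh n) (w : ℕ) (k : Fin n) (s : Mem F) :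
    Prop extends BuildEnv rs V I w s where
  elem_eq : s.ivar elemReg = (k : ℕ)
  shift_eq : s.ivar shiftReg = I.elemKey k
  entries_eq : ∀ j < Kt + Kh + 1, s.iarr entryArr j = I.entry k j

theorem TableFits.lt (h : TableFits rs V I) : n + Kt + Kh < V := by
  have h₁ := h.keys_le
  have h₂ : (n + 1) ^ 1 ≤ numKeys Kt Kh n := Nat.pow_le_pow_right (by omega) (by omega)
  rw [pow_one] at h₂
  omega

theorem BuildEnv.congr {s' : Mem F} (h : BuildEnv rs V I w s) (hb : s'.Bounded rs V)
    (hi : ∀ r ∈ [nReg, wReg, keysReg, countReg], s'.ivar r = s.ivar r)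
    (ha : ∀ a ∈ [catTArr, catHArr], s'.iarr a = s.iarr a)
    (hr : s'.rarr coeffArr = s.rarr coeffArr) : BuildEnv rs V I w s' where
  bounded := hb
  n_eq := (hi _ (by simp)).trans h.n_eq
  w_eq := (hi _ (by simp)).trans h.w_eq
  keys_eq := (hi _ (by simp)).trans h.keys_eq
  count_eq := (hi _ (by simp)).trans h.count_eq
  catT_eq i := (congrFun (ha _ (by simp)) _).trans (h.catT_eq i)
  catH_eq i := (congrFun (ha _ (by simp)) _).trans (h.catH_eq i)
  coeff_eq i := (congrFun hr _).trans (h.coeff_eq i)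

theorem ElemEnv.congr {s' : Mem F} (h : ElemEnv rs V I w k s) (hb : s'.Bounded rs V)
    (hi : ∀ r ∈ [nReg, wReg, keysReg, elemReg, shiftReg, countReg], s'.ivar r = s.ivar r)
    (ha : ∀ a ∈ [catTArr, catHArr, entryArr], s'.iarr a = s.iarr a)
    (hr : s'.rarr coeffArr = s.rarr coeffArr) : ElemEnv rs V I w k s' where
  toBuildEnv := h.toBuildEnv.congr hb (fun r hr => hi r (by simp at hr ⊢; tauto))
    (fun a h => ha a (by simp at h ⊢; tauto)) hr
  elem_eq := (hi _ (by simp)).trans h.elem_eq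
  shift_eq := (hi _ (by simp)).trans h.shift_eq
  entries_eq j hj := (congrFun (ha _ (by simp)) _).trans (h.entries_eq j hj)

/-! #### Updating a row -/

/-- The memory after the solution obtained from `x` by adding the element `k` has been written to
row `q`. -/
def Mem.writeRow (s : Mem F) (I : Inst F Kt Kh n) (q : ℤ) (x : Sol n) (k : Fin n) : Mem F :=
  ((((s.fill bitsArr (q * n) n fun i => toArray (bit x) i).setIA bitsArr (q * n + (k : ℕ)) 1).fill
    compsArr (q * (Kt + Kh + 1 : ℕ)) (Kt + Kh + 1) fun j => I.comp x j + I.entry k j).setRA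
    valueArr q (sumObj I.f x + I.f k)).setIA flagArr q 1

theorem isRow_writeRow {x : Sol n} (hxk : x k = false) :
    IsRow I (s.writeRow I q x k).iarr (s.writeRow I q x k).rarr q (Function.update x k true) where
  flag_eq := by simp [Mem.writeRow]
  bits_eq i := by
    rcases eq_or_ne i k with rfl | hi
    · simp [Mem.writeRow, bit]
    · have : (i : ℕ) ≠ k := Fin.val_ne_of_ne hi
      simp [Mem.writeRow, bit_update_true, hi, this, fillCells_add, toArray_coe]
  comps_eq j hj := by
    rw [I.comp_update hxk]
    simp [Mem.writeRow, fillCells_add hj]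
  value_eq := by simp [Mem.writeRow, sumObj_update _ hxk]

theorem sameRow_writeRow {x : Sol n} {q' : ℤ} (hq : q' ≠ q) :
    SameRow Kt Kh n s.iarr s.rarr (s.writeRow I q x k).iarr (s.writeRow I q x k).rarr q' where
  flag_eq := by simp [Mem.writeRow, hq]
  bits_eq i hi := by
    simp [Mem.writeRow, fillCells_of_row_ne hq le_rfl hi, mul_add_ne_of_ne hq hi k.2]
  comps_eq j hj := by simpa [Mem.writeRow] using fillCells_of_row_ne hq le_rfl hj
  value_eq := by simp [Mem.writeRow, hq]

theorem abs_toArray_bit_le (x : Sol n) (i : ℤ) : |toArray (bit x) i| ≤ 1 := by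
  unfold toArray
  split_ifs
  · rw [abs_of_nonneg (bit_nonneg x _)]
    exact bit_le_one x _
  · simp

theorem Inst.abs_comp_le {x : Sol n} {j : ℕ} (h : n ≤ V) : |I.comp x j| ≤ V := by
  rw [abs_of_nonneg (I.comp_nonneg x j)]
  exact (I.comp_le x j).trans (by exact_mod_cast h)

theorem runs_updateRow {Q : Mem F → Prop} (hC : IsSizeMeasure rs C) (hV : TableFits rs V I)
    (h : ElemEnv rs V I w k s) (hq : s.ivar rowReg = q) {x : Sol n} (hxk : x k = false)
    (hx : IsRow I s.iarr s.rarr (q - I.elemKey k) x)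
    (hQ : (s.writeRow I q x k).Bounded rs V → Q (s.writeRow I q x k)) :
    Runs rs C V (updateRow Kt Kh) s Q := by
  have hV' := hV.lt
  have hone : |(1 : ℤ)| ≤ V := by simp; omega
  have hne : q - I.elemKey k ≠ q := by have := I.elemKey_pos k; omega
  have hcomps : ∀ j < Kt + Kh + 1, |I.comp x j + I.entry k j| ≤ V := fun j _ => by
    rw [← I.comp_update hxk]
    exact Inst.abs_comp_le (by omega)
  refine .seq (.fillBlock (d := q * n) hC h.bounded (by omega : n ≤ V)
    (fun i _ => (abs_toArray_bit_le x i).trans (by omega)) (by simp [IExp.val, h.n_eq])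
    (fun i hi => ?_) fun hb => ?_)
  · have hcopy (v : ℕ → ℤ) := (fillCells_of_row_ne (v := v) hne hi.le hi).trans (hx.bits_eq ⟨i, hi⟩)
    simp [IExp.val, sourceE, h.n_eq, hq, h.shift_eq, hcopy, ← toArray_coe (bit x) ⟨i, hi⟩]
  refine .seq (.setIArr hb (i := q * n + (k : ℕ)) (by simp [IExp.val, h.n_eq, hq, h.elem_eq]) rfl
    hone fun hb => ?_)
  refine .seq (.fillBlock (d := q * (Kt + Kh + 1 : ℕ)) hC hb (by omega) hcomps
    (by simp [IExp.val]) (fun j hj => ?_) fun hb => ?_)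
  · have hcopy (v : ℕ → ℤ) := (fillCells_of_row_ne (v := v) hne hj.le hj).trans (hx.comps_eq j hj)
    push_cast at hcopy
    simp [IExp.val, sourceE, hq, h.shift_eq, h.entries_eq j hj, hcopy]
  refine .seq (.setRArr hC hb (i := q) (by simp [IExp.val, hq])
    (by simp [IExp.val, RExp.val, sourceE, hq, h.shift_eq, h.elem_eq, hx.value_eq, h.coeff_eq])
    (sumObj_update I.f hxk ▸ hV.sumObj_le _ : rs (sumObj I.f x + I.f k) ≤ V) fun hb => ?_)
  exact .setIArr hb (by simp [IExp.val, hq]) rfl hone hQ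

theorem SameRow.of_eq {F : Type} {A A' : ℕ → ℤ → ℤ} {B B' : ℕ → ℤ → F}
    (hA : ∀ a ∈ [flagArr, bitsArr, compsArr], A' a = A a) (hB : B' valueArr = B valueArr) :
    SameRow Kt Kh n A B A' B' q where
  flag_eq := congrFun (hA _ (by simp)) q
  bits_eq i _ := congrFun (hA _ (by simp)) _
  comps_eq j _ := congrFun (hA _ (by simp)) _
  value_eq := congrFun hB q

theorem runs_loadEntries (hC : IsSizeMeasure rs C) (hV : TableFits rs V I)
    (h : BuildEnv rs V I w s) (hk : s.ivar elemReg = (k : ℕ)) :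
    Runs rs C V (loadEntries Kt Kh) s fun s' => BuildEnv rs V I w s' ∧
      s'.ivar elemReg = (k : ℕ) ∧ (∀ j < Kt + Kh + 1, s'.iarr entryArr j = I.entry k j) ∧
      (∀ a ≠ entryArr, s'.iarr a = s.iarr a) ∧ s'.rarr = s.rarr := by
  have hV' := hV.lt
  have hone : |(1 : ℤ)| ≤ V := by simp; omega
  have hcatT := (I.catT k).2
  have hcatH := (I.catH k).2
  refine .seq (.fillBlock (d := 0) (N := Kt + Kh) (g := fun _ => 0) hC h.bounded (by omega)
    (by simp) (by simp [IExp.val]) (by simp [IExp.val]) fun hb => ?_)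
  refine .seq (.fillBlock (d := 0) (N := (I.catT k : ℕ) + 1) (g := fun _ => 1) hC hb (by omega)
    (fun _ _ => hone) (by simp [IExp.val, hk, h.catT_eq]) (by simp [IExp.val]) fun hb => ?_)
  refine .seq (.fillBlock (d := Kt) (N := (I.catH k : ℕ) + 1) (g := fun _ => 1) hC hb (by omega)
    (fun _ _ => hone) (by simp [IExp.val, hk, h.catH_eq]) (by simp [IExp.val]) fun hb => ?_)
  refine .setIArr hb rfl rfl hone fun hb => ⟨h.congr hb (by simp) (by simp) (by simp), by simp [hk],
    fun j hj => ?_, fun a ha => by simp [ha], by simp⟩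
  simp only [IExp.val, Nat.cast_add, Mem.setIA_iarr, ↓reduceIte, Mem.fill_iarr,
    Function.update_apply, fillCells, Nat.cast_le, Nat.cast_one, Nat.cast_nonneg, zero_add,
    Order.lt_add_one_iff, true_and, Inst.entry, tsub_le_iff_right]
  split_ifs <;> omega

theorem Inst.abs_elemKey_le (hV : TableFits rs V I) : |I.elemKey k| ≤ V := by
  have h₁ := I.key_lt (Function.update (fun _ => false) k true)
  have h₂ : (numKeys Kt Kh n : ℤ) + Kt + Kh ≤ V := by exact_mod_cast hV.keys_le
  rw [abs_of_pos (I.elemKey_pos k), I.elemKey_eq_key]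
  simp only [numKeys, Nat.cast_pow, Nat.cast_add, Nat.cast_one] at h₂
  omega

theorem improveTest_holds (h : ElemEnv rs V I w k s) (hq : s.ivar rowReg = q) :
    (improveTest γ).Holds s ↔ 1 ≤ s.iarr flagArr (q - I.elemKey k) ∧
      (1 ≤ s.iarr flagArr q →
        (γ : F) * (s.rarr valueArr (q - I.elemKey k) + I.f k) ≤ γ * s.rarr valueArr q) := by
  simp only [improveTest, BExp.Holds, IExp.val, RExp.val, sourceE, hq, h.shift_eq, h.elem_eq,
    h.coeff_eq, not_and, not_not]

/-- In addition, `l` steps of the downward sweep have been made: the rows of the `l` largest keys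
have been updated for the element `k`. -/
structure Swept (rs : F → ℕ) (V : ℕ) (I : Inst F Kt Kh n) (w : ℕ) (γ : ℤ) (k : Fin n) (l : ℕ)
    (s : Mem F) : Prop extends ElemEnv rs V I w k s where
  sweep_eq : s.ivar sweepReg = l
  low : ∀ q : ℤ, q + l < numKeys Kt Kh n → RowCorrect γ I k s.iarr s.rarr q
  high : ∀ q : ℤ, numKeys Kt Kh n ≤ q + l → RowCorrect γ I (k + 1) s.iarr s.rarr q

theorem bounded_input (hV : TableFits rs V I) (hw : w ≤ V) : (I.input w).Bounded rs V := by
  have hV' := hV.lt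
  have hzero : rs (0 : F) ≤ V := sumObj_false I.f ▸ hV.sumObj_le _
  have hcoeff (i : Fin n) : rs (I.f i) ≤ V := by
    have := hV.sumObj_le (Function.update (fun _ => false) i true)
    rwa [sumObj_update _ rfl, sumObj_false, zero_add] at this
  have hcat {m : ℕ} (hm : m + 1 ≤ V) : |(m : ℤ) + 1| ≤ V := abs_le.2 ⟨by omega, by omega⟩
  refine ⟨fun r => ?_, fun a i => ?_, fun _ => hzero, fun a i => ?_⟩
  · simp only [Inst.input]
    split_ifs
    exacts [abs_le.2 ⟨by omega, by omega⟩, abs_le.2 ⟨by omega, by omega⟩, by simp]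
  · simp only [Inst.input]
    split_ifs <;> simp only [toArray] <;> try split_ifs
    exacts [hcat (by have := (I.catT ⟨i.toNat, by omega⟩).2; omega), by simp,
      hcat (by have := (I.catH ⟨i.toNat, by omega⟩).2; omega), by simp, by simp]
  · simp only [Inst.input]
    split_ifs <;> simp only [toArray] <;> try split_ifs
    exacts [hcoeff _, hzero, hzero]

variable [IsOrderedAddMonoid F]

theorem runs_improveRow (hC : IsSizeMeasure rs C) (hV : TableFits rs V I)
    (h : ElemEnv rs V I w k s) (hq : s.ivar rowReg = q)
    (hsrc : RowCorrect γ I k s.iarr s.rarr (q - I.elemKey k))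
    (hrow : RowCorrect γ I k s.iarr s.rarr q) :
    Runs rs C V (.ite (improveTest γ) (updateRow Kt Kh) .skip) s fun s' =>
      ElemEnv rs V I w k s' ∧ (∀ r ≠ fillReg, s'.ivar r = s.ivar r) ∧
      RowCorrect γ I (k + 1) s'.iarr s'.rarr q ∧
      ∀ q' ≠ q, SameRow Kt Kh n s.iarr s.rarr s'.iarr s'.rarr q' := by
  refine .ite hC h.bounded (fun htest => ?_) fun htest => ?_
  · obtain ⟨hflag, himp⟩ := (improveTest_holds h hq).1 htest
    rcases hsrc with ⟨h₀, -⟩ | ⟨y, hy, hybest⟩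
    · omega
    have hyk : y k = false := hybest.1.1 k le_rfl
    refine runs_updateRow hC hV h hq hyk hy fun hb => ⟨h.congr hb ?_ ?_ ?_, ?_,
      .take hy hybest hrow himp (isRow_writeRow hyk), fun q' hq' => sameRow_writeRow hq'⟩
    · simp [Mem.writeRow]
    · simp [Mem.writeRow]
    · simp [Mem.writeRow]
    · intro r hr
      simp [Mem.writeRow, hr]
  · exact .skip ⟨h, fun _ _ => rfl, .keep hsrc hrow ((improveTest_holds h hq).not.1 htest),
      fun _ _ => .of_eq (fun _ _ => rfl) rfl⟩

theorem runs_sweepStep {l : ℕ} (hC : IsSizeMeasure rs C) (hV : TableFits rs V I)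
    (hl : l < numKeys Kt Kh n) (h : Swept rs V I w γ k l s) :
    Runs rs C V (sweepStep Kt Kh γ) s fun s' => s'.Bounded rs V ∧ s'.ivar sweepReg = l ∧
      Swept rs V I w γ k (l + 1) (s'.setI sweepReg (l + 1 : ℕ)) := by
  have hM : numKeys Kt Kh n ≤ V := by have := hV.keys_le; omega
  have hkey := I.elemKey_pos k
  obtain ⟨q, hq⟩ : ∃ q : ℤ, q = numKeys Kt Kh n - 1 - l := ⟨_, rfl⟩
  refine .seq (.setIVar (v := q) h.bounded (by simp [IExp.val, h.keys_eq, h.sweep_eq, hq])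
    (abs_le.2 ⟨by omega, by omega⟩) fun hb => ?_)
  refine (runs_improveRow (q := q) hC hV (h.toElemEnv.congr hb (by simp) (by simp) rfl) (by simp)
    (h.low _ (by omega)) (h.low _ (by omega))).imp fun s' ⟨h', hreg, hnew, hsame⟩ => ?_
  refine ⟨h'.bounded, by simp [hreg, h.sweep_eq],
    h'.congr (h'.bounded.setI _ (by rw [Nat.abs_cast]; omega)) (by simp) (by simp) rfl, by simp,
    fun q' hq' => ?_, fun q' hq' => ?_⟩
  · exact (h.low q' (by omega)).congr (hsame q' (by omega))
  · rcases eq_or_ne q' q with rfl | hne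
    · exact hnew
    · exact (h.high q' (by omega)).congr (hsame q' hne)

theorem runs_addElement (hC : IsSizeMeasure rs C) (hV : TableFits rs V I)
    (h : BuildEnv rs V I w s) (hk : s.ivar elemReg = (k : ℕ))
    (hrows : ∀ q, RowCorrect γ I k s.iarr s.rarr q) :
    Runs rs C V (addElement Kt Kh γ) s fun s' => BuildEnv rs V I w s' ∧
      s'.ivar elemReg = (k : ℕ) ∧ ∀ q, RowCorrect γ I (k + 1) s'.iarr s'.rarr q := by
  have hM : numKeys Kt Kh n ≤ V := by have := hV.keys_le; omega
  refine .seq ((runs_loadEntries hC hV h hk).imp fun s₁ ⟨h₁, hk₁, hent, hA, hB⟩ => ?_)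
  have hrows₁ (q : ℤ) : RowCorrect γ I k s₁.iarr s₁.rarr q :=
    (hrows q).congr (.of_eq (by simp [hA]) (by rw [hB]))
  refine .seq (.setIVar (v := I.elemKey k) h₁.bounded ?_ (Inst.abs_elemKey_le hV) fun hb => ?_)
  · rw [keyE_val, h₁.n_eq]
    exact Finset.sum_congr rfl fun j hj => by rw [hent j (Finset.mem_range.1 hj)]
  have henv : ElemEnv rs V I w k (s₁.setI shiftReg (I.elemKey k)) :=
    ⟨h₁.congr hb (by simp) (by simp) rfl, by simp [hk₁], by simp, hent⟩
  refine .forUp (Swept rs V I w γ k) hC hb hM ?_ (fun l s _ h => ⟨h.bounded, h.sweep_eq, h.keys_eq⟩)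
    (fun l s hl h => runs_sweepStep hC hV hl h) fun s h => ⟨h.toBuildEnv, h.elem_eq, fun q => ?_⟩
  · exact ⟨henv.congr (hb.setI _ (by simp)) (by simp) (by simp) rfl, by simp,
      fun q _ => hrows₁ q, fun q hq => (hrows₁ q).of_notMem fun hq' => by have := hq'.2; omega⟩
  · by_cases hq : 0 ≤ q
    · exact h.high q (by omega)
    · exact (h.low q (by omega)).of_notMem fun hq' => hq hq'.1

theorem runs_buildTable (hC : IsSizeMeasure rs C) (hV : TableFits rs V I) (hw : w ≤ V) :
    Runs rs C V (buildTable Kt Kh γ) (I.input w) fun s => BuildEnv rs V I w s ∧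
      ∀ q, RowCorrect γ I n s.iarr s.rarr q := by
  have hM : numKeys Kt Kh n ≤ V := by have := hV.keys_le; omega
  have hV' := hV.lt
  refine .seq (.setIVar (v := (numKeys Kt Kh n : ℕ)) (bounded_input hV hw)
    (by simp [powE_val, Inst.input, numKeys]) (by rw [Nat.abs_cast]; omega) fun hb => ?_)
  refine .seq (.setIArr (v := 1) hb rfl rfl (by simp; omega) fun hb => ?_)
  refine .forUp (fun k s => BuildEnv rs V I w s ∧ s.ivar elemReg = k ∧
      ∀ q, RowCorrect γ I k s.iarr s.rarr q) hC hb (by omega : n ≤ V) ⟨?_, by simp, fun q => ?_⟩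
    (fun k s _ hI => ⟨hI.1.bounded, hI.2.1, hI.1.n_eq⟩) (fun k s hk ⟨h, hreg, hrows⟩ => ?_)
    fun s hI => ⟨hI.1, hI.2.2⟩
  · refine ⟨hb.setI _ (by simp), ?_, ?_, ?_, ?_, ?_, ?_, ?_⟩ <;>
      simp [Inst.input, toArray]
  · rcases eq_or_ne q 0 with rfl | hq
    · refine .inr ⟨fun _ => false, ⟨?_, ?_, ?_, ?_⟩, ?_⟩ <;>
        simp [IExp.val, Inst.input, bit, I.comp_false, sumObj_false, Inst.IsBest, I.keyClass_zero]
    · exact .inl ⟨by simp [IExp.val, Inst.input, hq], by simp [I.keyClass_zero, hq]⟩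
  · refine (runs_addElement (k := ⟨k, hk⟩) hC hV h hreg hrows).imp fun s' ⟨h', hreg', hrows'⟩ =>
      ⟨h'.bounded, hreg', ?_, by simp, hrows'⟩
    exact h'.congr (h'.bounded.setI _ (by rw [Nat.abs_cast]; omega)) (by simp) (by simp) rfl

end Build

/-! ### Selection from the table -/

/-- The conjunction of the tests `b 0, …, b (m - 1)`. -/
def allBelow (b : ℕ → BExp) : ℕ → BExp
  | 0 => .leI (.const 0) (.const 0)
  | m + 1 => .and (allBelow b m) (b m)

/-- The entry `j` of the vector of components in the row whose key is in register `r`. -/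
def compE (Kt Kh r : ℕ) (j : IExp) : IExp :=
  .arr compsArr (.add (.mul (.var r) (.const (Kt + Kh + 1 : ℕ))) j)

/-- The row whose key is in register `r` holds a solution with `κ * ∑ i, x i = κ * w`. -/
def feasTest (Kt Kh : ℕ) (κ : ℤ) (r : ℕ) : BExp :=
  .and (.leI (.const 1) (.arr flagArr (.var r)))
    (.and (.leI (.mul (.const κ) (compE Kt Kh r (.const (Kt + Kh : ℕ))))
        (.mul (.const κ) (.var wReg)))
      (.leI (.mul (.const κ) (.var wReg))
        (.mul (.const κ) (compE Kt Kh r (.const (Kt + Kh : ℕ))))))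

/-- The outcome of the row with key in register `r` is at most the one for register `r'`. -/
def outcomeLeTest (Kt Kh : ℕ) (α β γ : ℤ) (r r' : ℕ) : BExp :=
  .and (allBelow (fun j => .leI (.mul (.const α) (compE Kt Kh r (.const j)))
      (.mul (.const α) (compE Kt Kh r' (.const j)))) Kt)
    (.and (allBelow (fun j => .leI (.mul (.const β) (compE Kt Kh r (.const (Kt + j : ℕ))))
        (.mul (.const β) (compE Kt Kh r' (.const (Kt + j : ℕ))))) Kh)
      (.leR (.mul (.ofInt (.const γ)) (.arr valueArr (.var r)))
        (.mul (.ofInt (.const γ)) (.arr valueArr (.var r')))))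

/-- The rival row is feasible and beats the current row. -/
def beatsTest (Kt Kh : ℕ) (α β γ κ : ℤ) : BExp :=
  .and (feasTest Kt Kh κ rivalReg) (.and (outcomeLeTest Kt Kh α β γ rivalReg rowReg)
    (.not (.and (outcomeLeTest Kt Kh α β γ rowReg rivalReg)
      (.leI (.var rowReg) (.var rivalReg)))))

/-- Sets `keepReg` to `1` if no feasible row beats the current row, and to `0` otherwise. -/
def searchRivals (Kt Kh : ℕ) (α β γ κ : ℤ) : Prog :=
  .seq (.setIVar keepReg (.const 1))
    (forUp rivalReg (.var keysReg)
      (.ite (beatsTest Kt Kh α β γ κ) (.setIVar keepReg (.const 0)) .skip))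

/-- Appends the solution in the current row and its outcome vector to the output. -/
def appendRow (Kt Kh : ℕ) (α β γ : ℤ) : Prog :=
  .seq (fillBlock solArr (.mul (.var countReg) (.var nReg)) (.var nReg)
    (.arr bitsArr (.add (.mul (.var rowReg) (.var nReg)) (.var fillReg))))
  (.seq (fillBlock fstArr (.mul (.var countReg) (.const Kt)) (.const Kt)
    (.mul (.const α) (compE Kt Kh rowReg (.var fillReg))))
  (.seq (fillBlock sndArr (.mul (.var countReg) (.const Kh)) (.const Kh)
    (.mul (.const β) (compE Kt Kh rowReg (.add (.const Kt) (.var fillReg)))))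
  (.seq (.setRArr outArr (.var countReg)
    (.mul (.ofInt (.const γ)) (.arr valueArr (.var rowReg))))
  (.setIVar countReg (.add (.var countReg) (.const 1))))))

/-- Appends the current row to the output if it is feasible and not beaten by a feasible row. -/
def scanRow (Kt Kh : ℕ) (α β γ κ : ℤ) : Prog :=
  .ite (feasTest Kt Kh κ rowReg)
    (.seq (searchRivals Kt Kh α β γ κ)
      (.ite (.leI (.const 1) (.var keepReg)) (appendRow Kt Kh α β γ) .skip))
    .skip

/-- Outputs the feasible rows that are not beaten by a feasible row. -/
def scanTable (Kt Kh : ℕ) (α β γ κ : ℤ) : Prog :=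
  .seq (forUp rowReg (.var keysReg) (scanRow Kt Kh α β γ κ))
    (.seq (.setIVar nReg (.var countReg)) (.setIVar wReg (.var countReg)))

/-! #### The output list -/

section Output

variable {F : Type} {Kt Kh n K : ℕ} {A : ℤ → ℤ} {l : List ℕ} {s : Mem F}
  {x : ℕ → Sol n} {Z : ℕ → Outcome F Kt Kh}

/-- The consecutive blocks of `K` cells of the array `A` hold the vectors `g q`, `q ∈ l`. -/
def HoldsBlocks (A : ℤ → ℤ) (g : ℕ → Fin K → ℤ) (l : List ℕ) : Prop :=
  ∀ (t : ℕ) (ht : t < l.length) (j : Fin K), A ((t : ℤ) * K + (j : ℕ)) = g l[t] j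

/-- The memory lists the solutions `x q` and the outcome vectors `Z q`, `q ∈ l`, in the output
format, except that their number is in `countReg`. -/
structure Written (x : ℕ → Sol n) (Z : ℕ → Outcome F Kt Kh) (l : List ℕ) (s : Mem F) : Prop where
  count_eq : s.ivar countReg = l.length
  sol : HoldsBlocks (s.iarr solArr) (fun q => bit (x q)) l
  fst : HoldsBlocks (s.iarr fstArr) (fun q => (Z q).1) l
  snd : HoldsBlocks (s.iarr sndArr) (fun q => (Z q).2.1) l
  out_eq : ∀ (t : ℕ) (ht : t < l.length), s.rarr outArr t = (Z l[t]).2.2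

/-- The memory after the solution `y` and the outcome vector `v` have been appended to an output
list with `c` entries. -/
def Mem.appendOutput (s : Mem F) (c : ℕ) (y : Sol n) (v : Outcome F Kt Kh) : Mem F :=
  ((((s.fill solArr (c * n) n fun i => toArray (bit y) i).fill
    fstArr (c * Kt) Kt fun j => toArray v.1 j).fill
    sndArr (c * Kh) Kh fun j => toArray v.2.1 j).setRA outArr c v.2.2).setI countReg (c + 1 : ℕ)

theorem HoldsBlocks.append {g : ℕ → Fin K → ℤ} (h : HoldsBlocks A g l) (q : ℕ) :
    HoldsBlocks (fillCells A (l.length * K) K fun j => toArray (g q) j) g (l ++ [q]) := by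
  intro t ht j
  rw [List.length_append, List.length_singleton] at ht
  rcases (Nat.lt_succ_iff.1 ht).lt_or_eq with hlt | rfl
  · rw [List.getElem_append_left hlt,
      fillCells_of_row_ne (by exact_mod_cast hlt.ne) le_rfl j.2, h t hlt]
  · rw [List.getElem_concat_length rfl, fillCells_add j.2, toArray_coe]

theorem Written.append (h : Written x Z l s) (q : ℕ) :
    Written x Z (l ++ [q]) (s.appendOutput l.length (x q) (Z q)) where
  count_eq := by simp [Mem.appendOutput]
  sol := by simpa [Mem.appendOutput] using h.sol.append q
  fst := by simpa [Mem.appendOutput] using h.fst.append q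
  snd := by simpa [Mem.appendOutput] using h.snd.append q
  out_eq t ht := by
    rw [List.length_append, List.length_singleton] at ht
    rcases (Nat.lt_succ_iff.1 ht).lt_or_eq with hlt | rfl
    · simp [Mem.appendOutput, List.getElem_append_left hlt, hlt.ne, h.out_eq t hlt]
    · simp [Mem.appendOutput]

theorem Written.congr {s' : Mem F} (h : Written x Z l s)
    (hc : s'.ivar countReg = s.ivar countReg)
    (hA : ∀ a ∈ [solArr, fstArr, sndArr], s'.iarr a = s.iarr a)
    (hB : s'.rarr outArr = s.rarr outArr) : Written x Z l s' where
  count_eq := hc.trans h.count_eq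
  sol := hA solArr (by simp) ▸ h.sol
  fst := hA fstArr (by simp) ▸ h.fst
  snd := hA sndArr (by simp) ▸ h.snd
  out_eq := hB ▸ h.out_eq

end Output

/-! #### Tests on the table -/

section Scan

variable {F : Type} [Ring F] [LinearOrder F] {Kt Kh n w : ℕ} {rs : F → ℕ} {C V : ℕ}
  {I : Inst F Kt Kh n} {s : Mem F} {α β γ κ : ℤ} {R : Set ℕ} {x : ℕ → Sol n}

theorem allBelow_holds {b : ℕ → BExp} {m : ℕ} :
    (allBelow b m).Holds s ↔ ∀ j < m, (b j).Holds s := by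
  induction m with
  | zero => simp [allBelow, BExp.Holds]
  | succ m ih => rw [allBelow, BExp.Holds, ih, Nat.forall_lt_succ_right]

/-- The solutions with `κ * ∑ i, x i = κ * w`: the factor `κ` switches the cardinality constraint
on and off. -/
def feasible (n w : ℕ) (κ : ℤ) : Set (Sol n) := {x | κ * ∑ i, bit x i = κ * w}

/-- The indices in `R` of feasible solutions. -/
def candidates (w : ℕ) (κ : ℤ) (R : Set ℕ) (x : ℕ → Sol n) : Set ℕ :=
  {q | q ∈ R ∧ x q ∈ feasible n w κ}

/-- The memory holds the parameters and a table whose nonempty rows, with the keys `q ∈ R`, contain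
the solutions `x q`. -/
structure ScanEnv (rs : F → ℕ) (V : ℕ) (I : Inst F Kt Kh n) (w : ℕ) (R : Set ℕ) (x : ℕ → Sol n)
    (s : Mem F) : Prop where
  bounded : s.Bounded rs V
  n_eq : s.ivar nReg = n
  w_eq : s.ivar wReg = w
  keys_eq : s.ivar keysReg = numKeys Kt Kh n
  lt_of_mem : ∀ q ∈ R, q < numKeys Kt Kh n
  isRow : ∀ q ∈ R, IsRow I s.iarr s.rarr q (x q)
  flag_eq : ∀ q : ℕ, q ∉ R → s.iarr flagArr q = 0

theorem ScanEnv.congr {s' : Mem F} (h : ScanEnv rs V I w R x s) (hb : s'.Bounded rs V)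
    (hi : ∀ r ∈ [nReg, wReg, keysReg], s'.ivar r = s.ivar r)
    (hA : ∀ a ∈ [flagArr, bitsArr, compsArr], s'.iarr a = s.iarr a)
    (hB : s'.rarr valueArr = s.rarr valueArr) : ScanEnv rs V I w R x s' where
  bounded := hb
  n_eq := (hi _ (by simp)).trans h.n_eq
  w_eq := (hi _ (by simp)).trans h.w_eq
  keys_eq := (hi _ (by simp)).trans h.keys_eq
  lt_of_mem := h.lt_of_mem
  isRow q hq := (h.isRow q hq).congr (.of_eq hA hB)
  flag_eq q hq := (congrFun (hA _ (by simp)) _).trans (h.flag_eq q hq)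

theorem IsRow.compE_val {r : ℕ} {q : ℤ} {y : Sol n} (h : IsRow I s.iarr s.rarr q y)
    (hr : s.ivar r = q) {e : IExp} {j : ℕ} (he : e.val s = j) (hj : j < Kt + Kh + 1) :
    (compE Kt Kh r e).val s = I.comp y j := by
  simp only [compE, IExp.val, hr, he, h.comps_eq j hj]

theorem feasTest_holds {r q : ℕ} (h : ScanEnv rs V I w R x s) (hr : s.ivar r = q) :
    (feasTest Kt Kh κ r).Holds s ↔ q ∈ candidates w κ R x := by
  by_cases hq : q ∈ R
  · have hcard := (h.isRow q hq).compE_val hr (e := .const (Kt + Kh : ℕ)) rfl (by omega)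
    simp only [feasTest, BExp.Holds, IExp.val, hcard, hr, (h.isRow q hq).flag_eq, h.w_eq]
    simp [candidates, feasible, hq, I.sum_bit, le_antisymm_iff]
  · simp [feasTest, BExp.Holds, IExp.val, hr, h.flag_eq q hq, candidates, hq]

theorem outcomeLeTest_holds {r r' : ℕ} {q q' : ℤ} {y y' : Sol n}
    (hy : IsRow I s.iarr s.rarr q y) (hr : s.ivar r = q)
    (hy' : IsRow I s.iarr s.rarr q' y') (hr' : s.ivar r' = q') :
    (outcomeLeTest Kt Kh α β γ r r').Holds s ↔ outcome α β γ I y ≤ outcome α β γ I y' := by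
  have hcomp {j : ℕ} (hj : j < Kt + Kh + 1) := hy.compE_val hr (e := .const j) rfl hj
  have hcomp' {j : ℕ} (hj : j < Kt + Kh + 1) := hy'.compE_val hr' (e := .const j) rfl hj
  simp only [outcomeLeTest, BExp.Holds, allBelow_holds, RExp.val, IExp.val, hr, hr', hy.value_eq,
    hy'.value_eq, outcome, Prod.mk_le_mk, Pi.le_def, I.countVec_catT, I.countVec_catH]
  refine and_congr ?_ (and_congr ?_ Iff.rfl) <;>
    exact Iff.trans (forall₂_congr fun j hj => by rw [hcomp (by omega), hcomp' (by omega)])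
      Fin.forall_iff.symm

theorem beatsTest_holds {p q : ℕ} (h : ScanEnv rs V I w R x s) (hp : s.ivar rivalReg = p)
    (hq : s.ivar rowReg = q) (hqR : q ∈ R) :
    (beatsTest Kt Kh α β γ κ).Holds s ↔
      p ∈ candidates w κ R x ∧ Beats (outcome α β γ I ∘ x) p q := by
  rw [beatsTest, BExp.Holds, feasTest_holds h hp]
  refine and_congr_right fun hpA => ?_
  have hprow := h.isRow p hpA.1
  have hqrow := h.isRow q hqR
  simp only [BExp.Holds, outcomeLeTest_holds hprow hp hqrow hq,
    outcomeLeTest_holds hqrow hq hprow hp, Beats, Function.comp_apply, IExp.val, hp, hq,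
    Nat.cast_le]

/-! #### The scan -/

/-- The memory `s'` differs from `s` only in the registers used by the search for rivals. -/
structure SameOutsideSearch (s s' : Mem F) : Prop where
  ivar_eq : ∀ r, r ≠ rivalReg → r ≠ keepReg → s'.ivar r = s.ivar r
  iarr_eq : s'.iarr = s.iarr
  rarr_eq : s'.rarr = s.rarr

theorem SameOutsideSearch.setI {F : Type} {s s' : Mem F} (h : SameOutsideSearch s s') {r : ℕ}
    (hr : r ∈ [rivalReg, keepReg]) (v : ℤ) : SameOutsideSearch s (s'.setI r v) where
  ivar_eq r' h₁ h₂ := by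
    have : r' ≠ r := by rintro rfl; simp [h₁, h₂] at hr
    simp [this, h.ivar_eq r' h₁ h₂]
  iarr_eq := h.iarr_eq
  rarr_eq := h.rarr_eq

theorem ScanEnv.of_sameOutsideSearch {s' : Mem F} (h : ScanEnv rs V I w R x s)
    (hs : SameOutsideSearch s s') (hb : s'.Bounded rs V) : ScanEnv rs V I w R x s' :=
  h.congr hb (by simp [hs.ivar_eq]) (by simp [hs.iarr_eq]) (by rw [hs.rarr_eq])

theorem runs_searchRivals {q : ℕ} (hC : IsSizeMeasure rs C) (hV : TableFits rs V I)
    (h : ScanEnv rs V I w R x s) (hq : s.ivar rowReg = q) (hqA : q ∈ candidates w κ R x) :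
    Runs rs C V (searchRivals Kt Kh α β γ κ) s fun s' => s'.Bounded rs V ∧
      SameOutsideSearch s s' ∧ (1 ≤ s'.ivar keepReg ↔
        q ∈ kept (candidates w κ R x) (outcome α β γ I ∘ x)) := by
  have hV₀ := hV.lt
  have hV₁ := hV.keys_le
  set A := candidates w κ R x
  set Z := outcome α β γ I ∘ x
  refine .seq (.setIVar (v := 1) h.bounded rfl (by simp; omega) fun hb => ?_)
  refine .forUp (N := numKeys Kt Kh n) (fun p s' => s'.Bounded rs V ∧ SameOutsideSearch s s' ∧
      s'.ivar rivalReg = p ∧ (1 ≤ s'.ivar keepReg ↔ ∀ p' < p, p' ∈ A → ¬ Beats Z p' q))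
    hC hb (by omega) ?_ ?_ ?_ ?_
  · exact ⟨hb.setI _ (by simp), .setI (.setI ⟨fun _ _ _ => rfl, rfl, rfl⟩ (by simp) 1) (by simp) 0,
      by simp, by simp⟩
  · rintro p s' - ⟨hb', hs, hp, -⟩
    exact ⟨hb', hp, (hs.ivar_eq _ (by simp) (by simp)).trans h.keys_eq⟩
  · rintro p s' hp ⟨hb', hs, hreg, hkeep⟩
    have htest := beatsTest_holds (α := α) (β := β) (γ := γ) (κ := κ)
      (h.of_sameOutsideSearch hs hb') hreg ((hs.ivar_eq _ (by simp) (by simp)).trans hq) hqA.1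
    have hpV : |((p + 1 : ℕ) : ℤ)| ≤ V := by rw [Nat.abs_cast]; omega
    refine .ite hC hb' (fun hbeats => ?_) fun hbeats => ?_
    · refine .setIVar (v := 0) hb' rfl (by simp) fun hb'' => ⟨hb'', by simp [hreg],
        hb''.setI _ hpV, (hs.setI (by simp) _).setI (by simp) _, by simp, ?_⟩
      exact iff_of_false (by simp) fun hall =>
        hall p p.lt_succ_self (htest.1 hbeats).1 (htest.1 hbeats).2
    · refine .skip ⟨hb', hreg, hb'.setI _ hpV, hs.setI (by simp) _, by simp, ?_⟩
      rw [htest, not_and] at hbeats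
      rw [Nat.forall_lt_succ_right, and_iff_left hbeats]
      simpa using hkeep
  · rintro s' ⟨hb', hs, -, hkeep⟩
    exact ⟨hb', hs, hkeep.trans ⟨fun hall => ⟨hqA, fun p hp => hall p (h.lt_of_mem p hp.1) hp⟩,
      fun hmem p _ => hmem.2 p⟩⟩

/-- All quantities that occur in the table and in the outcome vectors have size at most `V`. -/
structure OutcomesFit (α β γ : ℤ) (rs : F → ℕ) (V : ℕ) (I : Inst F Kt Kh n) : Prop
    extends TableFits rs V I where
  fst_le : ∀ x j, |(outcome α β γ I x).1 j| ≤ V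
  snd_le : ∀ x j, |(outcome α β γ I x).2.1 j| ≤ V
  value_le : ∀ x, rs (outcome α β γ I x).2.2 ≤ V

theorem abs_toArray_le {n : ℕ} {v : Fin n → ℤ} (hv : ∀ j, |v j| ≤ V) (i : ℤ) :
    |toArray v i| ≤ V := by
  unfold toArray
  split_ifs
  exacts [hv _, by simp]

theorem runs_appendRow {Q : Mem F → Prop} {q : ℤ} {c : ℕ} {y : Sol n} (hC : IsSizeMeasure rs C)
    (hV : OutcomesFit α β γ rs V I) (hb : s.Bounded rs V) (hn : s.ivar nReg = n)
    (hq : s.ivar rowReg = q) (hc : s.ivar countReg = c) (hcV : c < V)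
    (hy : IsRow I s.iarr s.rarr q y)
    (hQ : (s.appendOutput c y (outcome α β γ I y)).Bounded rs V →
      Q (s.appendOutput c y (outcome α β γ I y))) :
    Runs rs C V (appendRow Kt Kh α β γ) s Q := by
  have hV₀ := hV.lt
  refine .seq (.fillBlock (d := c * n) (g := fun i => toArray (bit y) i) hC hb (by omega : n ≤ V)
    (fun i _ => (abs_toArray_bit_le y i).trans (by omega)) (by simp [IExp.val, hn])
    (fun i hi => ?_) fun hb => ?_)
  · simp [IExp.val, hn, hq, hc, hy.bits_eq ⟨i, hi⟩, ← toArray_coe (bit y) ⟨i, hi⟩]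
  refine .seq (.fillBlock (d := c * Kt) (g := fun j => toArray (outcome α β γ I y).1 j) hC hb
    (by omega : Kt ≤ V) (fun j _ => abs_toArray_le (hV.fst_le y) j) (by simp [IExp.val])
    (fun j hj => ?_) fun hb => ?_)
  · have := hy.comps_eq j (by omega)
    push_cast at this
    simp [IExp.val, compE, hq, hc, this, toArray_coe _ (⟨j, hj⟩ : Fin Kt), outcome,
      I.countVec_catT]
  refine .seq (.fillBlock (d := c * Kh) (g := fun j => toArray (outcome α β γ I y).2.1 j) hC hb
    (by omega : Kh ≤ V) (fun j _ => abs_toArray_le (hV.snd_le y) j) (by simp [IExp.val])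
    (fun j hj => ?_) fun hb => ?_)
  · have := hy.comps_eq (Kt + j) (by omega)
    push_cast at this
    simp [IExp.val, compE, hq, hc, this, toArray_coe _ (⟨j, hj⟩ : Fin Kh), outcome,
      I.countVec_catH]
  refine .seq (.setRArr hC hb (i := c) (by simp [IExp.val, hc])
    (by simp [IExp.val, RExp.val, hq, hy.value_eq, outcome]) (hV.value_le y) fun hb => ?_)
  exact .setIVar hb (by simp [IExp.val, hc]) (by rw [Nat.abs_cast]; omega) hQ

/-- During the scan, the rows with keys below `q` have been examined. -/
structure Scanned (rs : F → ℕ) (V : ℕ) (I : Inst F Kt Kh n) (w : ℕ) (α β γ κ : ℤ) (R : Set ℕ)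
    (x : ℕ → Sol n) (q : ℕ) (s : Mem F) : Prop extends ScanEnv rs V I w R x s where
  row_eq : s.ivar rowReg = q
  written : Written x (outcome α β γ I ∘ x)
    (keptBelow (candidates w κ R x) (outcome α β γ I ∘ x) q) s

theorem Scanned.next_of_notMem {q : ℕ} (h : Scanned rs V I w α β γ κ R x q s)
    (hq : q ∉ kept (candidates w κ R x) (outcome α β γ I ∘ x)) (hqV : q < V) :
    Scanned rs V I w α β γ κ R x (q + 1) (s.setI rowReg (q + 1 : ℕ)) where
  toScanEnv := h.toScanEnv.congr (h.bounded.setI _ (by rw [Nat.abs_cast]; omega)) (by simp)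
    (by simp) rfl
  row_eq := by simp
  written := by
    rw [keptBelow_succ_of_notMem hq]
    exact h.written.congr (by simp) (by simp) rfl

theorem runs_scanRow {q : ℕ} (hC : IsSizeMeasure rs C) (hV : OutcomesFit α β γ rs V I)
    (hq : q < numKeys Kt Kh n) (h : Scanned rs V I w α β γ κ R x q s) :
    Runs rs C V (scanRow Kt Kh α β γ κ) s fun s' => s'.Bounded rs V ∧ s'.ivar rowReg = q ∧
      Scanned rs V I w α β γ κ R x (q + 1) (s'.setI rowReg (q + 1 : ℕ)) := by
  have hqV : q < V := by have := hV.keys_le; omega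
  refine .ite hC h.bounded (fun hfeas => ?_) fun hfeas => ?_
  swap
  · rw [feasTest_holds h.toScanEnv h.row_eq] at hfeas
    exact .skip ⟨h.bounded, h.row_eq, h.next_of_notMem (fun hmem => hfeas hmem.1) hqV⟩
  rw [feasTest_holds h.toScanEnv h.row_eq] at hfeas
  refine .seq ((runs_searchRivals hC hV.toTableFits h.toScanEnv h.row_eq hfeas).imp
    fun s₁ ⟨hb, hs, hkeep⟩ => ?_)
  have h₁ : Scanned rs V I w α β γ κ R x q s₁ :=
    ⟨h.toScanEnv.of_sameOutsideSearch hs hb, (hs.ivar_eq _ (by simp) (by simp)).trans h.row_eq,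
      h.written.congr (hs.ivar_eq _ (by simp) (by simp)) (by simp [hs.iarr_eq])
        (by rw [hs.rarr_eq])⟩
  refine .ite hC hb (fun hmem => ?_) fun hmem => ?_
  · refine runs_appendRow hC hV hb h₁.n_eq h₁.row_eq h₁.written.count_eq
      ((length_keptBelow_le ..).trans_lt hqV) (h₁.isRow q hfeas.1) fun hb' =>
        ⟨hb', by simp [Mem.appendOutput, h₁.row_eq], ?_, by simp, ?_⟩
    · exact h₁.toScanEnv.congr (hb'.setI _ (by rw [Nat.abs_cast]; omega))
        (by simp [Mem.appendOutput]) (by simp [Mem.appendOutput]) (by simp [Mem.appendOutput])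
    · rw [keptBelow_succ_of_mem (hkeep.1 hmem)]
      exact (h₁.written.append q).congr (by simp) (by simp) rfl
  · exact .skip ⟨hb, h₁.row_eq, h₁.next_of_notMem (fun h => hmem (hkeep.2 h)) hqV⟩

theorem runs_scanTable (hC : IsSizeMeasure rs C) (hV : OutcomesFit α β γ rs V I)
    (h : ScanEnv rs V I w R x s) (hc : s.ivar countReg = 0) :
    Runs rs C V (scanTable Kt Kh α β γ κ) s fun s' =>
      s'.ivar nReg = s'.ivar countReg ∧ s'.ivar wReg = s'.ivar countReg ∧
      Written x (outcome α β γ I ∘ x)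
        (keptBelow (candidates w κ R x) (outcome α β γ I ∘ x) (numKeys Kt Kh n)) s' := by
  have hM : numKeys Kt Kh n ≤ V := by have := hV.keys_le; omega
  refine .seq (.forUp (Scanned rs V I w α β γ κ R x) hC h.bounded hM ?_
    (fun q s _ h => ⟨h.bounded, h.row_eq, h.keys_eq⟩) (fun q s hq h => runs_scanRow hC hV hq h)
    fun s₁ h₁ => ?_)
  · exact ⟨h.congr (h.bounded.setI _ (by simp)) (by simp) (by simp) rfl, by simp,
      by simp [keptBelow, hc], by simp [keptBelow, HoldsBlocks], by simp [keptBelow, HoldsBlocks],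
      by simp [keptBelow, HoldsBlocks], by simp [keptBelow]⟩
  · refine .seq (.setIVar h₁.bounded rfl (h₁.bounded.ivar_le _) fun hb => ?_)
    refine .setIVar hb rfl (hb.ivar_le _) fun _ => ⟨by simp [IExp.val], by simp [IExp.val], ?_⟩
    exact h₁.written.congr (by simp) (by simp) rfl

end Scan

/-! ### Correctness and running time -/

/-- The dynamic program followed by the selection from its table, with the cardinality constraint
if `κ = 1` and without it if `κ = 0`. -/
def solver (Kt Kh : ℕ) (α β γ κ : ℤ) : Prog :=
  .seq (buildTable Kt Kh γ) (scanTable Kt Kh α β γ κ)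

theorem feasible_zero (n w : ℕ) : feasible n w 0 = Set.univ := by
  simp [feasible]

theorem feasible_one (n w : ℕ) : feasible n w 1 = cardFeasible n w := by
  simp [feasible, cardFeasible]

theorem isCorrectOutput_of_written {F : Type} [LinearOrder F] {Kt Kh n M : ℕ} {X : Set (Sol n)}
    {z : Sol n → Outcome F Kt Kh} {A : Set ℕ} {x : ℕ → Sol n} {s : Mem F}
    (h : IsDominatingFamily X z A x) (hM : ∀ q ∈ A, q < M)
    (hs : Written x (z ∘ x) (keptBelow A (z ∘ x) M) s)
    (h₀ : s.ivar nReg = s.ivar countReg) (h₁ : s.ivar wReg = s.ivar countReg) :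
    IsCorrectOutput X z s := by
  set l := keptBelow A (z ∘ x) M
  have hmem : {q | q ∈ l} = kept A (z ∘ x) := by
    ext q
    exact mem_keptBelow.trans (and_iff_right_of_imp fun hq => hM q hq.1)
  have hinj : Function.Injective (z ∘ x ∘ l.get) := fun t t' htt' =>
    (nodup_keptBelow A (z ∘ x) M).injective_get
      (injOn_kept A (z ∘ x) (hmem.le (l.get_mem t)) (hmem.le (l.get_mem t')) htt')
  have hrange {B : Type} (g : ℕ → B) : Set.range (g ∘ l.get) = g '' kept A (z ∘ x) := by
    rw [Set.range_comp, Set.range_list_get, hmem]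
  exact ⟨⟨l.length, z ∘ x ∘ l.get, hinj, (hrange (z ∘ x)).trans h.nondominatedSet_eq.symm,
      h₁.trans hs.count_eq, fun t => hs.fst t t.2, fun t => hs.snd t t.2, fun t => hs.out_eq t t.2⟩,
    _, h.isMinimalComplete, l.length, x ∘ l.get, hinj.of_comp, hrange x,
    h₀.trans hs.count_eq, fun t => hs.sol t t.2⟩

section Solver

variable {F : Type} [Ring F] [LinearOrder F] {Kt Kh n w : ℕ} {rs : F → ℕ} {C V : ℕ}
  {α β γ κ : ℤ} {s : Mem F} {x : ℕ → Sol n}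

/-- The keys of solutions. -/
def Inst.keySet (I : Inst F Kt Kh n) : Set ℕ := {q | (I.keyClass n q).Nonempty}

variable {I : Inst F Kt Kh n}

theorem outcome_le_of_key_eq {y y' : Sol n} (hkey : I.key y = I.key y')
    (hle : (γ : F) * sumObj I.f y ≤ γ * sumObj I.f y') :
    outcome α β γ I y ≤ outcome α β γ I y' := by
  refine ⟨fun j => ?_, fun j => ?_, hle⟩
  · simp only [outcome, I.countVec_catT, I.comp_eq_of_key_eq hkey (j := j) (by omega), le_refl]
  · simp only [outcome, I.countVec_catH, I.comp_eq_of_key_eq hkey (j := Kt + j) (by omega),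
      le_refl]

theorem isDominatingFamily_of_isBest (hx : ∀ q ∈ I.keySet, I.IsBest γ n q (x q)) :
    IsDominatingFamily (feasible n w κ) (outcome α β γ I) (candidates w κ I.keySet x) x where
  mem _ hq := hq.2
  exists_le y hy := by
    obtain ⟨q, hq⟩ := Int.eq_ofNat_of_zero_le (I.key_nonneg y)
    have hyq : y ∈ I.keyClass n q := hq ▸ I.mem_keyClass_key y
    obtain ⟨hmem, hle⟩ := hx q ⟨y, hyq⟩
    have hkey : I.key (x q) = I.key y := hmem.2.trans hq.symm
    refine ⟨q, ⟨⟨y, hyq⟩, ?_⟩, outcome_le_of_key_eq hkey (hle y hyq)⟩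
    simpa only [feasible, Set.mem_ofPred_eq, I.sum_bit, I.comp_eq_of_key_eq hkey
      (Nat.lt_succ_self (Kt + Kh))] using hy

theorem BuildEnv.exists_scanEnv (h : BuildEnv rs V I w s)
    (hrows : ∀ q, RowCorrect γ I n s.iarr s.rarr q) :
    ∃ x, (∀ q ∈ I.keySet, I.IsBest γ n q (x q)) ∧ ScanEnv rs V I w I.keySet x s := by
  have hex (q : ℕ) (hq : q ∈ I.keySet) : ∃ y, IsRow I s.iarr s.rarr q y ∧ I.IsBest γ n q y :=
    (hrows q).resolve_left fun hempty => hq.ne_empty hempty.2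
  choose! x hx using hex
  refine ⟨x, fun q hq => (hx q hq).2, h.bounded, h.n_eq, h.w_eq, h.keys_eq, fun q hq => ?_,
    fun q hq => (hx q hq).1, fun q hq => ?_⟩
  · by_contra hlt
    exact hq.ne_empty (Inst.keyClass_eq_empty fun hmem => hlt (by exact_mod_cast hmem.2))
  · rcases hrows q with hempty | ⟨y, -, hy⟩
    · exact hempty.1
    · exact absurd ⟨y, hy.1⟩ hq

theorem runs_solver [IsOrderedAddMonoid F] (hC : IsSizeMeasure rs C)
    (hV : OutcomesFit α β γ rs V I) (hw : w ≤ V) :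
    Runs rs C V (solver Kt Kh α β γ κ) (I.input w)
      (IsCorrectOutput (feasible n w κ) (outcome α β γ I)) := by
  refine .seq ((runs_buildTable hC hV.toTableFits hw).imp fun s ⟨hs, hrows⟩ => ?_)
  obtain ⟨x, hx, hscan⟩ := hs.exists_scanEnv hrows
  exact (runs_scanTable hC hV hscan hs.count_eq).imp fun s' ⟨h₀, h₁, hout⟩ =>
    isCorrectOutput_of_written (isDominatingFamily_of_isBest hx)
      (fun q hq => hscan.lt_of_mem q hq.1) hout h₀ h₁

theorem le_inputSize (rs : F → ℕ) (I : Inst F Kt Kh n) (w : ℕ) : n ≤ I.inputSize rs w := by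
  have hterms : ∑ _i : Fin n, 1 ≤ ∑ i, (intSize (((I.catT i : ℕ) : ℤ) + 1) +
      intSize (((I.catH i : ℕ) : ℤ) + 1) + rs (I.f i)) :=
    Finset.sum_le_sum fun i _ => by
      have := one_le_intSize (((I.catT i : ℕ) : ℤ) + 1)
      omega
  simp only [Finset.sum_const, Finset.card_univ, Fintype.card_fin, smul_eq_mul, mul_one] at hterms
  unfold Inst.inputSize
  omega

theorem IsSizeMeasure.sumObj_le (hC : IsSizeMeasure rs C) (I : Inst F Kt Kh n) (w : ℕ)
    (x : Sol n) : rs (sumObj I.f x) ≤ C * (1 + I.inputSize rs w) := by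
  have hcoeffs : ∑ i with x i = true, rs (I.f i) ≤ I.inputSize rs w := calc
    _ ≤ ∑ i, rs (I.f i) := Finset.sum_le_univ_sum_of_nonneg fun _ => Nat.zero_le _
    _ ≤ ∑ i, (intSize (((I.catT i : ℕ) : ℤ) + 1) + intSize (((I.catH i : ℕ) : ℤ) + 1) +
          rs (I.f i)) := Finset.sum_le_sum fun i _ => Nat.le_add_left _ _
    _ ≤ _ := Nat.le_add_left _ _
  rw [sumObj_eq_sum_filter]
  exact (hC.sum_le _ _).trans (by gcongr)

open Polynomial in
/-- The value of this polynomial at the encoding length of the input bounds the memory contents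
during a run of the solver. -/
noncomputable def memoryBound (Kt Kh : ℕ) (α β γ : ℤ) (C : ℕ) : ℕ[X] :=
  (X + 1) ^ (Kt + Kh + 1) + (Kt : ℕ[X]) + (Kh : ℕ[X]) +
    ((α.natAbs : ℕ[X]) * X + (β.natAbs : ℕ[X]) * X) + (C : ℕ[X]) * (1 + X) +
    (C : ℕ[X]) * ((C : ℕ[X]) * (intSize γ : ℕ[X]) + (C : ℕ[X]) * (1 + X))

theorem abs_mul_comp_le (a : ℤ) (I : Inst F Kt Kh n) (x : Sol n) (j : ℕ) :
    |a * I.comp x j| ≤ (a.natAbs * n : ℕ) := by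
  rw [abs_mul, Nat.cast_mul, Int.natCast_natAbs]
  gcongr
  exact Inst.abs_comp_le le_rfl

theorem outcomesFit_memoryBound (hC : IsSizeMeasure rs C) (I : Inst F Kt Kh n) (w : ℕ) :
    OutcomesFit α β γ rs ((memoryBound Kt Kh α β γ C).eval (I.inputSize rs w)) I := by
  have hn := le_inputSize rs I w
  have hsum := hC.sumObj_le I w
  set m := I.inputSize rs w
  have hkeys : numKeys Kt Kh n ≤ (m + 1) ^ (Kt + Kh + 1) := by
    unfold numKeys
    gcongr
  have hα := Nat.mul_le_mul_left α.natAbs hn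
  have hβ := Nat.mul_le_mul_left β.natAbs hn
  have heval : (memoryBound Kt Kh α β γ C).eval m = (m + 1) ^ (Kt + Kh + 1) + Kt + Kh +
      (α.natAbs * m + β.natAbs * m) + C * (1 + m) + C * (C * intSize γ + C * (1 + m)) := by
    simp [memoryBound]
  rw [heval]
  refine ⟨⟨by omega, fun x => (hsum x).trans (by omega)⟩, fun x j => ?_, fun x j => ?_,
    fun x => ?_⟩
  · simp only [outcome, I.countVec_catT]
    exact (abs_mul_comp_le α I x j).trans (by exact_mod_cast (by omega))
  · simp only [outcome, I.countVec_catH]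
    exact (abs_mul_comp_le β I x (Kt + j)).trans (by exact_mod_cast (by omega))
  · have hγ : rs (γ * sumObj I.f x) ≤ C * (C * intSize γ + C * (1 + m)) :=
      (hC.mul_le _ _).trans (by gcongr; exacts [hC.int_le γ, hsum x])
    exact hγ.trans (Nat.le_add_left _ _)

theorem exists_polynomial_solver [IsOrderedAddMonoid F] (hC : IsSizeMeasure rs C)
    (Kt Kh : ℕ) (α β γ κ : ℤ) :
    ∃ p : Polynomial ℕ, ∀ (n : ℕ) (I : Inst F Kt Kh n) (w : ℕ), w ≤ n →
      ∃ (t : ℕ) (s : Mem F), Exec rs (solver Kt Kh α β γ κ) (I.input w) t s ∧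
        t ≤ p.eval (I.inputSize rs w) ∧ IsCorrectOutput (feasible n w κ) (outcome α β γ I) s := by
  refine ⟨((solver Kt Kh α β γ κ).costBound C).comp (memoryBound Kt Kh α β γ C),
    fun n I w hw => ?_⟩
  have hV := outcomesFit_memoryBound (α := α) (β := β) (γ := γ) hC I w
  have hwV := hV.lt
  rw [Polynomial.eval_comp]
  exact runs_solver hC hV (by omega)

theorem solvesOMUCO_solver [IsOrderedAddMonoid F] (hC : IsSizeMeasure rs C) (Kt Kh : ℕ)
    (α β γ : ℤ) : SolvesOMUCO rs Kt Kh α β γ (solver Kt Kh α β γ 0) := by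
  obtain ⟨p, hp⟩ := exists_polynomial_solver hC Kt Kh α β γ 0
  exact ⟨p, fun n I => by simpa only [feasible_zero] using hp n I 0 n.zero_le⟩

theorem solvesOMCOCC_solver [IsOrderedAddMonoid F] (hC : IsSizeMeasure rs C) (Kt Kh : ℕ)
    (α β γ : ℤ) : SolvesOMCOCC rs Kt Kh α β γ (solver Kt Kh α β γ 1) := by
  obtain ⟨p, hp⟩ := exists_polynomial_solver hC Kt Kh α β γ 1
  exact ⟨p, fun n I w hw => by simpa only [feasible_one] using hp n I w hw⟩

end Solver

end OrdMUCO

theorem mainTheorem1_general (Kt Kh : ℕ) (α β γ : ℤ) :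
    (∃ P : OrdMUCO.Prog, ∀ (F : Type) [Ring F] [LinearOrder F] [IsOrderedAddMonoid F]
      (rs : F → ℕ) (C : ℕ), OrdMUCO.IsSizeMeasure rs C →
        OrdMUCO.SolvesOMUCO rs Kt Kh α β γ P) ∧
    (∃ P : OrdMUCO.Prog, ∀ (F : Type) [Ring F] [LinearOrder F] [IsOrderedAddMonoid F]
      (rs : F → ℕ) (C : ℕ), OrdMUCO.IsSizeMeasure rs C →
        OrdMUCO.SolvesOMCOCC rs Kt Kh α β γ P) :=
  ⟨⟨_, fun _ _ _ _ _ _ hC => OrdMUCO.solvesOMUCO_solver hC Kt Kh α β γ⟩,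
    ⟨_, fun _ _ _ _ _ _ hC => OrdMUCO.solvesOMCOCC_solver hC Kt Kh α β γ⟩⟩

theorem mainTheorem1 (Kt Kh : ℕ) (α β γ : ℤ)
    (hα : α ∈ ({-1, 0, 1} : Set ℤ)) (hβ : β ∈ ({-1, 0, 1} : Set ℤ))
    (hγ : γ ∈ ({-1, 0, 1} : Set ℤ)) :
    (∃ P : OrdMUCO.Prog,
      OrdMUCO.SolvesOMUCO OrdMUCO.realSize Kt Kh α β γ P ∧
      OrdMUCO.SolvesOMUCO OrdMUCO.ratSize Kt Kh α β γ P) ∧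
    (∃ P : OrdMUCO.Prog,
      OrdMUCO.SolvesOMCOCC OrdMUCO.realSize Kt Kh α β γ P ∧
      OrdMUCO.SolvesOMCOCC OrdMUCO.ratSize Kt Kh α β γ P) := by
  obtain ⟨⟨P, hP⟩, Q, hQ⟩ := mainTheorem1_general Kt Kh α β γ
  exact ⟨⟨P, hP ℝ _ _ OrdMUCO.isSizeMeasure_realSize, hP ℚ _ _ OrdMUCO.isSizeMeasure_ratSize⟩,
    Q, hQ ℝ _ _ OrdMUCO.isSizeMeasure_realSize, hQ ℚ _ _ OrdMUCO.isSizeMeasure_ratSize⟩
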